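/- **Theorem.** Let $n\ge 3$. Let $\mathbb T\subset\mathbb C$ be the unit circle, $M_f$ the multiplication operator by $f\in C(\mathbb T^m)$ on $\ell^2(\mathbb Z^m)\cong L^2(\mathbb T^m)$, and let $\mathcal T$ be the Toeplitz algebra, i.e. the $C^*$-algebra on $\ell^2(\mathbb Z_{\ge0})$ generated by the compressions $T_f$ of $M_f$, $f\in C(\mathbb T)$; let $\gamma\colon\mathcal T\to C(\mathbb T)$ be the $*$-homomorphism with $\gamma(T_f)=f$. For $\mathcal A\subset\{1,\dots,n\}$ let $\mathcal T^n_{\mathcal A}=A_1\otimes\cdots\otimes A_n$ ($C^*$-tensor product), where $A_i=C(\mathbb T)$ for $i\in\mathcal A$ and $A_i=\mathcal T$ for $i\notin\mathcal A$, acting on $\ell^2(\{x\in\mathbb Z^n: x_i\ge0\text{ for } i\notin\mathcal A\})$, with $f\in C(\mathbb T)$ acting on $\ell^2(\mathbb Z)$ as $M_f$. For $\mathcal D\subset\mathcal R$ let $\pi^{\mathcal D}_{\mathcal R}\colon\mathcal T^n_{\mathcal D}\to\mathcal T^n_{\mathcal R}$ be the $*$-homomorphism $a_1\otimes\cdots\otimes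 a_n$ with $a_i=\gamma$ for $i\in\mathcal R\setminus\mathcal D$ and $a_i=\mathrm{id}$ otherwise. Write $\mathcal T^n=\mathcal T^n_\emptyset=\mathcal T^{\otimes n}$, $\mathcal T^n_i=\mathcal T^n_{\{i\}}$, $\pi_{\mathcal A}=\pi^\emptyset_{\mathcal A}$, $\pi_i=\pi_{\{i\}}$, $\pi^i_{\mathcal A}=\pi^{\{i\}}_{\mathcal A}$, $\pi^i_{ij}=\pi^{\{i\}}_{\{i,j\}}$, and set $$\mathcal S^n=\{(T_1,\dots,T_n)\in\mathcal T^n_1\oplus\cdots\oplus\mathcal T^n_n:\ \pi^i_{ij}(T_i)=\pi^j_{ij}(T_j)\ \text{for } 1\le i<j\le n\},\qquad \gamma_n(T)=(\pi_1(T),\dots,\pi_n(T)).$$ Then: 1. $\mathcal T^n$ is the $C^*$-algebra on $\ell^2((\mathbb Z_{\ge0})^n)$ generated by the Toeplitz operators $P_nM_fP_n$, $f\in C(\mathbb T^n)$, where $P_n$ is the orthogonal projection of $\ell^2(\mathbb Z^n)$ onto $\ell^2((\mathbb Z_{\ge 0})^n)$; and $\mathcal S^n$ is a $C^*$-subalgebra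 of $\mathcal T^n_1\oplus\cdots\oplus\mathcal T^n_n$. 2. There is a short exact sequence of $C^*$-algebras $$0\to\mathcal K(\ell^2((\mathbb Z_{\ge0})^n))\xrightarrow{\ \iota_n\ }\mathcal T^n\xrightarrow{\ \gamma_n\ }\mathcal S^n\to0,$$ where $\iota_n$ is the inclusion of the compact operators. 3. For $(T_1,\dots,T_n)\in\mathcal S^n$ and nonempty $\mathcal A\subset\{1,\dots,n\}$, the element $T_{\mathcal A}=\pi^i_{\mathcal A}(T_i)\in\mathcal T^n_{\mathcal A}$ does not depend on $i\in\mathcal A$. For every $\mathcal A$, compression onto $\ell^2((\mathbb Z_{\ge0})^n)$ defines a linear map $\rho_{\mathcal A}\colon\mathcal T^n_{\mathcal A}\to\mathcal T^n$ with $\pi_{\mathcal A}\circ\rho_{\mathcal A}=\mathrm{id}$. The linear map $$\rho'\colon\mathcal S^n\to\mathcal T^n,\qquad \rho'(T_1,\dots,T_n)=\sum_{k=1}^n\ \sum_{|\mathcal A|=k}(-1)^{k+1}\rho_{\mathcal A}(T_{\mathcal A})$$ is a splitting of $\gamma_n$, i.e. $\gamma_n\circ\rho'=\mathrm{id}_{\mathcal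 S^n}$. -/

import Mathlib

open Filter Topology
open scoped ENNReal ComplexConjugate

noncomputable section

namespace OrthantToeplitz

/-- The unital `C*`-subalgebra generated by a set. -/
def cstarGen {A : Type} [TopologicalSpace A] [Ring A] [StarRing A] [IsTopologicalRing A]
    [ContinuousStar A] [Algebra ℂ A] [StarModule ℂ A] (S : Set A) : StarSubalgebra ℂ A :=
  (StarAlgebra.adjoin ℂ S).topologicalClosure

theorem isClosed_tendsto {V F : Type} [NormedAddCommGroup V] [NormedSpace ℂ V]
    [NormedAddCommGroup F] [NormedSpace ℂ F] (B : ℕ → V →ₗ[ℂ] F) (C : ℝ)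
    (hB : ∀ k v, ‖B k v‖ ≤ C * ‖v‖) :
    IsClosed {v | Tendsto (fun k => B k v) atTop (𝓝 0)} := by
  have hC : 0 ≤ |C| := abs_nonneg C
  refine isClosed_of_closure_subset fun v hv => ?_
  rw [Set.mem_ofPred_eq, Metric.tendsto_atTop]
  intro ε hε
  obtain ⟨w, hw, hvw⟩ := Metric.mem_closure_iff.1 hv (ε / (2 * (|C| + 1))) (by positivity)
  obtain ⟨N, hN⟩ := Metric.tendsto_atTop.1 hw (ε / 2) (by positivity)
  refine ⟨N, fun k hk => ?_⟩
  have h1 := hN k hk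
  rw [dist_zero_right] at h1 ⊢
  rw [dist_eq_norm] at hvw
  have h2 : ‖B k (v - w)‖ ≤ ε / 2 := by
    refine (hB k _).trans ?_
    calc C * ‖v - w‖ ≤ (|C| + 1) * (ε / (2 * (|C| + 1))) := by
          gcongr
          linarith [le_abs_self C]
      _ = ε / 2 := by field_simp
  calc ‖B k v‖ = ‖B k (v - w) + B k w‖ := by rw [map_sub, sub_add_cancel]
    _ ≤ ‖B k (v - w)‖ + ‖B k w‖ := norm_add_le _ _
    _ < ε := by linarith

section abstract_hom
variable {H H' : Type} [NormedAddCommGroup H] [InnerProductSpace ℂ H] [CompleteSpace H]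
  [NormedAddCommGroup H'] [InnerProductSpace ℂ H'] [CompleteSpace H']

/-- Pairs `(T, T')` with `T W_k - W_k T' → 0` and `T* W_k - W_k T'* → 0` strongly. -/
def asymp (W : ℕ → H' →L[ℂ] H) : StarSubalgebra ℂ ((H →L[ℂ] H) × (H' →L[ℂ] H')) where
  carrier := {p | ∀ ξ, Tendsto (fun k => p.1 (W k ξ) - W k (p.2 ξ)) atTop (𝓝 0) ∧
    Tendsto (fun k => (star p).1 (W k ξ) - W k ((star p).2 ξ)) atTop (𝓝 0)}
  mul_mem' := by
    have key : ∀ p q : (H →L[ℂ] H) × (H' →L[ℂ] H'),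
        (∀ ξ, Tendsto (fun k => p.1 (W k ξ) - W k (p.2 ξ)) atTop (𝓝 0)) →
        (∀ ξ, Tendsto (fun k => q.1 (W k ξ) - W k (q.2 ξ)) atTop (𝓝 0)) → ∀ ξ,
        Tendsto (fun k => (p * q).1 (W k ξ) - W k ((p * q).2 ξ)) atTop (𝓝 0) := by
      intro p q hp hq ξ
      have h1 := (p.1.continuous.tendsto 0).comp (hq ξ)
      have h2 := h1.add (hp (q.2 ξ))
      simp only [map_zero, add_zero] at h2
      refine h2.congr fun k => ?_
      simp
    intro p q hp hq ξ
    refine ⟨key p q (fun η => (hp η).1) (fun η => (hq η).1) ξ, ?_⟩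
    rw [star_mul]
    exact key _ _ (fun η => (hq η).2) (fun η => (hp η).2) ξ
  add_mem' := by
    intro p q hp hq ξ
    constructor
    · have := (hp ξ).1.add (hq ξ).1
      simp only [add_zero] at this
      refine this.congr fun k => ?_
      simp; abel
    · have := (hp ξ).2.add (hq ξ).2
      simp only [add_zero] at this
      refine this.congr fun k => ?_
      simp; abel
  algebraMap_mem' := by
    intro c ξ
    constructor <;> simp [Algebra.algebraMap_eq_smul_one]
  star_mem' := by
    intro p hp ξ
    rw [star_star]
    exact ⟨(hp ξ).2, (hp ξ).1⟩

theorem isClosed_asymp (W : ℕ → H' →L[ℂ] H) (hW : ∀ k, ‖W k‖ ≤ 1) :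
    IsClosed (asymp W : Set ((H →L[ℂ] H) × (H' →L[ℂ] H'))) := by
  have key : ∀ ξ, IsClosed {p : (H →L[ℂ] H) × (H' →L[ℂ] H') |
      Tendsto (fun k => p.1 (W k ξ) - W k (p.2 ξ)) atTop (𝓝 0)} := by
    intro ξ
    refine isClosed_tendsto (fun k => ((ContinuousLinearMap.apply ℂ (H) (W k ξ) :
      (H →L[ℂ] H) →ₗ[ℂ] H) ∘ₗ LinearMap.fst ℂ ((H →L[ℂ] H)) ((H' →L[ℂ] H')) -
      (W k : H' →ₗ[ℂ] H) ∘ₗ (ContinuousLinearMap.apply ℂ (H') ξ :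
      (H' →L[ℂ] H') →ₗ[ℂ] H') ∘ₗ LinearMap.snd ℂ ((H →L[ℂ] H)) ((H' →L[ℂ] H')))) (2 * ‖ξ‖) fun k p => ?_
    have h1 : ‖p.1 (W k ξ)‖ ≤ ‖p‖ * ‖ξ‖ := by
      refine (p.1.le_opNorm _).trans ?_
      have := (W k).le_of_opNorm_le (hW k) ξ
      rw [one_mul] at this
      gcongr
      exact norm_fst_le p
    have h2 : ‖W k (p.2 ξ)‖ ≤ ‖p‖ * ‖ξ‖ := by
      have := (W k).le_of_opNorm_le (hW k) (p.2 ξ)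
      rw [one_mul] at this
      refine this.trans ((p.2.le_opNorm _).trans ?_)
      gcongr
      exact norm_snd_le p
    refine (norm_sub_le _ _).trans ?_
    refine (add_le_add h1 h2).trans (le_of_eq (by ring))
  have : (asymp W : Set ((H →L[ℂ] H) × (H' →L[ℂ] H'))) = ⋂ ξ, ({p : (H →L[ℂ] H) × (H' →L[ℂ] H') |
      Tendsto (fun k => p.1 (W k ξ) - W k (p.2 ξ)) atTop (𝓝 0)} ∩ star ⁻¹' {p : (H →L[ℂ] H) × (H' →L[ℂ] H') |
      Tendsto (fun k => p.1 (W k ξ) - W k (p.2 ξ)) atTop (𝓝 0)}) := by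
    ext p
    simp only [Set.mem_iInter]
    rfl
  rw [this]
  exact isClosed_iInter fun ξ => (key ξ).inter ((key ξ).preimage continuous_star)

/-- `W_k` are contractions and `W_k* W_k → 1` strongly. -/
def Adm (W : ℕ → H' →L[ℂ] H) : Prop :=
  (∀ k, ‖W k‖ ≤ 1) ∧ ∀ ξ, Tendsto (fun k => (W k).adjoint (W k ξ)) atTop (𝓝 ξ)

theorem norm_le_of_asymp {W : ℕ → H' →L[ℂ] H} (hW : Adm W)
    {p : (H →L[ℂ] H) × (H' →L[ℂ] H')} (hp : p ∈ asymp W) : ‖p.2‖ ≤ ‖p.1‖ := by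
  refine ContinuousLinearMap.opNorm_le_bound _ (norm_nonneg _) fun ξ => ?_
  have hW' : ∀ k, ‖(W k).adjoint‖ ≤ 1 := fun k => by
    rw [LinearIsometryEquiv.norm_map]; exact hW.1 k
  have h1 : Tendsto (fun k => (W k).adjoint (W k (p.2 ξ)) - p.2 ξ) atTop (𝓝 0) := by
    simpa using (hW.2 (p.2 ξ)).sub_const (p.2 ξ)
  have h2 : Tendsto (fun k => (W k).adjoint (p.1 (W k ξ) - W k (p.2 ξ))) atTop (𝓝 0) := by
    refine squeeze_zero_norm (fun k => ?_) ((hp ξ).1.norm.trans (by simp))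
    simpa only [one_mul] using (W k).adjoint.le_of_opNorm_le (hW' k) (p.1 (W k ξ) - W k (p.2 ξ))
  have h3 : Tendsto (fun k => (W k).adjoint (p.1 (W k ξ))) atTop (𝓝 (p.2 ξ)) := by
    have := (h2.add h1).add_const (p.2 ξ)
    simp only [add_zero, zero_add] at this
    refine this.congr fun k => ?_
    simp
  refine le_of_tendsto h3.norm (Eventually.of_forall fun k => ?_)
  have a := (W k).adjoint.le_of_opNorm_le (hW' k) (p.1 (W k ξ))
  have b := p.1.le_opNorm (W k ξ)
  have c := (W k).le_of_opNorm_le (hW.1 k) ξ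
  rw [one_mul] at a c
  exact a.trans (b.trans (by gcongr))

theorem subset_cstarGen {A : Type} [TopologicalSpace A] [Ring A] [StarRing A]
    [IsTopologicalRing A] [ContinuousStar A] [Algebra ℂ A] [StarModule ℂ A] {S : Set A} {a : A}
    (h : a ∈ S) : a ∈ cstarGen S :=
  StarSubalgebra.le_topologicalClosure _ (StarAlgebra.subset_adjoin ℂ S h)

theorem cstarGen_le {A : Type} [TopologicalSpace A] [Ring A] [StarRing A]
    [IsTopologicalRing A] [ContinuousStar A] [Algebra ℂ A] [StarModule ℂ A] {S : Set A}
    {B : StarSubalgebra ℂ A} (h : S ⊆ B) (hB : IsClosed (B : Set A)) : cstarGen S ≤ B :=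
  StarSubalgebra.topologicalClosure_minimal (StarAlgebra.adjoin_le h) hB

/-- The generator `g i` as an element of the `C*`-algebra generated by all of them. -/
def genElem {A I : Type} [TopologicalSpace A] [Ring A] [StarRing A]
    [IsTopologicalRing A] [ContinuousStar A] [Algebra ℂ A] [StarModule ℂ A] (g : I → A) (i : I) :
    cstarGen (Set.range g) := ⟨g i, subset_cstarGen ⟨i, rfl⟩⟩

theorem hom_ext {I : Type} {g : I → (H →L[ℂ] H)} (B : StarSubalgebra ℂ ((H' →L[ℂ] H')))
    {φ ψ : cstarGen (Set.range g) →⋆ₐ[ℂ] B} (h : ∀ i, φ (genElem g i) = ψ (genElem g i)) :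
    φ = ψ := by
  have : IsClosed (cstarGen (Set.range g) : Set ((H →L[ℂ] H))) :=
    StarSubalgebra.isClosed_topologicalClosure _
  have key : ∀ φ : cstarGen (Set.range g) →⋆ₐ[ℂ] B, Continuous (fun x => (φ x : (H' →L[ℂ] H'))) :=
    fun φ => AddMonoidHomClass.continuous_of_bound (B.subtype.comp φ) 1 fun x => by
      simpa only [one_mul] using! NonUnitalStarAlgHom.norm_apply_le (B.subtype.comp φ) x
  have : (B.subtype.comp φ) = (B.subtype.comp ψ) := by
    refine StarAlgHom.ext_topologicalClosure (key φ) (key ψ) ?_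
    refine StarAlgHom.ext_adjoin ?_
    rintro ⟨_, hx⟩ ⟨i, rfl⟩
    exact congrArg Subtype.val (h i)
  refine StarAlgHom.ext fun x => Subtype.ext ?_
  exact congrArg (fun f => f x) this

theorem asymp_star {W : ℕ → H' →L[ℂ] H} {S : H →L[ℂ] H} {T : H' →L[ℂ] H'}
    (h : (S, T) ∈ asymp W) : (star S, star T) ∈ asymp W := by
  intro ξ
  have := h ξ
  exact ⟨this.2, by simpa using this.1⟩

theorem isClosed_map_fst {W : ℕ → H' →L[ℂ] H} (hW : Adm W)
    (P : StarSubalgebra ℂ ((H →L[ℂ] H) × (H' →L[ℂ] H'))) (hPG : P ≤ asymp W)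
    (hPc : IsClosed (P : Set ((H →L[ℂ] H) × (H' →L[ℂ] H')))) :
    IsClosed {T : H →L[ℂ] H | ∃ T', (T, T') ∈ P} := by
  have : CompleteSpace P := hPc.completeSpace_coe
  have h1 : AntilipschitzWith 1 (fun p : P => (p : (H →L[ℂ] H) × (H' →L[ℂ] H')).1) := by
    refine AntilipschitzWith.of_le_mul_dist fun p q => ?_
    have := norm_le_of_asymp hW (sub_mem (hPG p.2) (hPG q.2))
    rw [Subtype.dist_eq, dist_eq_norm, dist_eq_norm, Prod.norm_def]
    simpa using this
  have h2 : UniformContinuous (fun p : P => (p : (H →L[ℂ] H) × (H' →L[ℂ] H')).1) :=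
    uniformContinuous_fst.comp uniformContinuous_subtype_val
  convert! h1.isClosed_range h2
  ext T
  constructor
  · rintro ⟨T', hp⟩
    exact ⟨⟨_, hp⟩, rfl⟩
  · rintro ⟨⟨⟨p, p'⟩, hp⟩, rfl⟩
    exact ⟨p', hp⟩

theorem exists_partner {I J : Type} {W : ℕ → H' →L[ℂ] H} (hW : Adm W) (g : I → (H →L[ℂ] H))
    (g' : J → (H' →L[ℂ] H')) (e : I → J) (hg : ∀ i, (g i, g' (e i)) ∈ asymp W) (T : H →L[ℂ] H)
    (hT : T ∈ cstarGen (Set.range g)) :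
    ∃ T' ∈ cstarGen (Set.range g'), (T, T') ∈ asymp W := by
  let P : StarSubalgebra ℂ ((H →L[ℂ] H) × (H' →L[ℂ] H')) := asymp W ⊓
    (cstarGen (Set.range g')).comap (StarAlgHom.snd ℂ (H →L[ℂ] H) (H' →L[ℂ] H'))
  have hPc : IsClosed (P : Set ((H →L[ℂ] H) × (H' →L[ℂ] H'))) :=
    (isClosed_asymp W hW.1).inter
      ((StarSubalgebra.isClosed_topologicalClosure _).preimage continuous_snd)
  have hcl := isClosed_map_fst hW P inf_le_left hPc
  have hle : cstarGen (Set.range g) ≤ P.map (StarAlgHom.fst ℂ (H →L[ℂ] H) (H' →L[ℂ] H')) := by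
    refine cstarGen_le ?_ ?_
    · rintro _ ⟨i, rfl⟩
      exact ⟨(g i, g' (e i)), ⟨hg i, (genElem g' (e i)).2⟩, rfl⟩
    · convert! hcl
      ext T
      constructor
      · rintro ⟨⟨p, p'⟩, hp, rfl⟩
        exact ⟨p', hp⟩
      · rintro ⟨T', hp⟩
        exact ⟨_, hp, rfl⟩
  obtain ⟨⟨p, p'⟩, hp, rfl⟩ := hle hT
  exact ⟨p', hp.2, hp.1⟩

theorem exists_hom {I J : Type} {W : ℕ → H' →L[ℂ] H} (hW : Adm W) (g : I → (H →L[ℂ] H))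
    (g' : J → (H' →L[ℂ] H')) (e : I → J) (hg : ∀ i, (g i, g' (e i)) ∈ asymp W) :
    ∃ π : cstarGen (Set.range g) →⋆ₐ[ℂ] cstarGen (Set.range g'),
      (∀ i, π (genElem g i) = genElem g' (e i)) ∧
      ∀ T : cstarGen (Set.range g), ((T : H →L[ℂ] H), (π T : H' →L[ℂ] H')) ∈ asymp W := by
  have hu : ∀ (S : H →L[ℂ] H) (T T' : H' →L[ℂ] H'), (S, T) ∈ asymp W → (S, T') ∈ asymp W →
      T = T' := by
    intro S T T' h h'
    have := norm_le_of_asymp hW (sub_mem h h')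
    simpa [sub_eq_zero] using this
  have hex : ∀ T : cstarGen (Set.range g), ∃ T' : cstarGen (Set.range g'),
      ((T : H →L[ℂ] H), (T' : H' →L[ℂ] H')) ∈ asymp W := by
    rintro ⟨T, hT⟩
    obtain ⟨T', h, h'⟩ := exists_partner hW g g' e hg T hT
    exact ⟨⟨T', h⟩, h'⟩
  choose f hf using hex
  have hu' : ∀ (S : cstarGen (Set.range g)) (T : cstarGen (Set.range g')),
      ((S : H →L[ℂ] H), (T : H' →L[ℂ] H')) ∈ asymp W → f S = T :=
    fun S T h => Subtype.ext (hu S (f S) T (hf S) h)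
  clear hu
  have h1 : f 1 = 1 := hu' 1 1 (by exact (asymp W).one_mem)
  have h0 : f 0 = 0 := hu' 0 0 (by exact (asymp W).zero_mem)
  have hmul : ∀ S T, f (S * T) = f S * f T := by
    intro S T
    apply hu'
    have := (asymp W).mul_mem (hf S) (hf T)
    rwa [Prod.mk_mul_mk] at this
  have hadd : ∀ S T, f (S + T) = f S + f T := by
    intro S T
    apply hu'
    have := (asymp W).add_mem (hf S) (hf T)
    rwa [Prod.mk_add_mk] at this
  have hstar : ∀ S, f (star S) = star (f S) := by
    intro S
    apply hu'
    have := asymp_star (hf S)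
    rwa [← StarMemClass.coe_star, ← StarMemClass.coe_star] at this
  have halg : ∀ c : ℂ, f (algebraMap ℂ _ c) = algebraMap ℂ _ c := by
    intro c
    apply hu'
    exact (asymp W).algebraMap_mem c
  refine ⟨{ toFun := f, map_one' := h1, map_zero' := h0, map_mul' := hmul, map_add' := hadd,
            map_star' := hstar, commutes' := halg }, ?_, hf⟩
  exact fun i => hu' _ _ (hg i)

theorem existsUnique_hom {I J : Type} {W : ℕ → H' →L[ℂ] H} (hW : Adm W) (g : I → (H →L[ℂ] H))
    (g' : J → (H' →L[ℂ] H')) (e : I → J) (hg : ∀ i, (g i, g' (e i)) ∈ asymp W) :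
    ∃! π : cstarGen (Set.range g) →⋆ₐ[ℂ] cstarGen (Set.range g'),
      ∀ i, π (genElem g i) = genElem g' (e i) := by
  obtain ⟨φ, hφ, -⟩ := exists_hom hW g g' e hg
  exact ⟨φ, hφ, fun ψ hψ => hom_ext _ fun i => (hψ i).trans (hφ i).symm⟩

theorem hom_asymp {I J : Type} {W : ℕ → H' →L[ℂ] H} (hW : Adm W) (g : I → (H →L[ℂ] H))
    (g' : J → (H' →L[ℂ] H')) (e : I → J) (hg : ∀ i, (g i, g' (e i)) ∈ asymp W)
    (π : cstarGen (Set.range g) →⋆ₐ[ℂ] cstarGen (Set.range g'))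
    (hπ : ∀ i, π (genElem g i) = genElem g' (e i)) (T : cstarGen (Set.range g)) :
    ((T : H →L[ℂ] H), (π T : H' →L[ℂ] H')) ∈ asymp W := by
  obtain ⟨φ, hφ, h'⟩ := exists_hom hW g g' e hg
  have : π = φ := hom_ext _ fun i => (hπ i).trans (hφ i).symm
  rw [this]
  exact h' T

theorem hom_comp {H'' : Type} [NormedAddCommGroup H''] [InnerProductSpace ℂ H'']
    [CompleteSpace H''] {I J L : Type} {g : I → (H →L[ℂ] H)} {g' : J → (H' →L[ℂ] H')}
    {g'' : L → (H'' →L[ℂ] H'')} {e : I → J} {e' : J → L} {e'' : I → L}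
    (φ : cstarGen (Set.range g) →⋆ₐ[ℂ] cstarGen (Set.range g'))
    (ψ : cstarGen (Set.range g') →⋆ₐ[ℂ] cstarGen (Set.range g''))
    (χ : cstarGen (Set.range g) →⋆ₐ[ℂ] cstarGen (Set.range g''))
    (hφ : ∀ i, φ (genElem g i) = genElem g' (e i)) (hψ : ∀ i, ψ (genElem g' i) = genElem g'' (e' i))
    (hχ : ∀ i, χ (genElem g i) = genElem g'' (e'' i)) (he : ∀ i, e' (e i) = e'' i)
    (T : cstarGen (Set.range g)) : ψ (φ T) = χ T := by
  have : ψ.comp φ = χ := hom_ext _ fun i => by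
    rw [StarAlgHom.comp_apply, hφ, hψ, hχ, he]
  rw [← this]
  rfl

theorem isCompact_adjoint {T : H →L[ℂ] H} (hT : IsCompactOperator T) :
    IsCompactOperator T.adjoint := by
  have hS : IsCompactOperator (T ∘L T.adjoint) := hT.comp_clm T.adjoint
  have hK := (hS.isCompact_closure_image_closedBall
    (f := ((T ∘L T.adjoint : H →L[ℂ] H) : H →ₗ[ℂ] H)) 1).totallyBounded.subset subset_closure
  refine (isCompactOperator_iff_isCompact_closure_image_closedBall
    ((T.adjoint : H →L[ℂ] H) : H →ₗ[ℂ] H) one_pos).2 ?_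
  refine TotallyBounded.isCompact_of_isClosed (TotallyBounded.closure ?_) isClosed_closure
  refine Metric.totallyBounded_iff.2 fun ε hε => ?_
  obtain ⟨t, hts, htf, hcov⟩ := hK.exists_subset (Metric.dist_mem_uniformity
    (show 0 < ε ^ 2 / 2 by positivity))
  choose f hf hf' using hts
  have : Finite t := htf
  refine ⟨Set.range fun y : t => T.adjoint (f y.2), Set.finite_range _, ?_⟩
  rintro _ ⟨x, hx, rfl⟩
  obtain ⟨y, hy, hxy⟩ := Set.mem_iUnion₂.1 (hcov ⟨x, hx, rfl⟩)
  refine Set.mem_iUnion₂.2 ⟨_, ⟨⟨y, hy⟩, rfl⟩, ?_⟩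
  have h1 : ‖T (T.adjoint (x - f hy))‖ < ε ^ 2 / 2 := by
    have h2 : T (T.adjoint (f hy)) = y := hf' hy
    have h3 : dist (T (T.adjoint x)) y < ε ^ 2 / 2 := hxy
    rwa [← h2, dist_eq_norm, ← map_sub, ← map_sub] at h3
  have h2 : ‖x - f hy‖ ≤ 2 := by
    have a := mem_closedBall_zero_iff.1 hx
    have b := mem_closedBall_zero_iff.1 (hf hy)
    exact (norm_sub_le _ _).trans (by linarith)
  have h3 : ‖T.adjoint (x - f hy)‖ ^ 2 ≤ ‖T (T.adjoint (x - f hy))‖ * ‖x - f hy‖ := by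
    rw [← inner_self_eq_norm_sq (𝕜 := ℂ), ContinuousLinearMap.adjoint_inner_right]
    exact (RCLike.re_le_norm _).trans (norm_inner_le_norm _ _)
  have h4 : ‖T.adjoint (x - f hy)‖ ^ 2 < ε ^ 2 := by
    nlinarith [norm_nonneg (T (T.adjoint (x - f hy))), norm_nonneg (x - f hy)]
  have h5 := lt_of_pow_lt_pow_left₀ 2 hε.le h4
  rw [map_sub] at h5
  exact mem_ball_iff_norm.2 h5

end abstract_hom

/-- The Hilbert space `ℓ²(ι)`. -/
abbrev L2 (ι : Type) : Type := lp (fun _ : ι => ℂ) 2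

/-- Bounded operators on `ℓ²(ι)`. -/
abbrev Op (ι : Type) : Type := L2 ι →L[ℂ] L2 ι

/-- Restriction of an `ℓ²` function along an injection `j : ι ↪ κ`, i.e. `ξ ↦ ξ ∘ j`.
Its adjoint is the isometry `ℓ²(ι) → ℓ²(κ)`, `δ_i ↦ δ_{j i}`. -/
def restr {ι κ : Type} (j : ι ↪ κ) : L2 κ →L[ℂ] L2 ι :=
  LinearMap.mkContinuous
    { toFun := fun ξ => ⟨fun i => ξ (j i), by
        have h := (memℓp_gen_iff (by norm_num : 0 < (2 : ℝ≥0∞).toReal)).1 (lp.memℓp ξ)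
        exact memℓp_gen (h.comp_injective j.injective)⟩
      map_add' := fun ξ η => by ext i; rfl
      map_smul' := fun c ξ => by ext i; rfl } 1 (fun ξ => by
        rw [one_mul]
        refine lp.norm_le_of_forall_sum_le (by norm_num) (norm_nonneg _) fun s => ?_
        have := lp.sum_rpow_le_norm_rpow (by norm_num : 0 < (2 : ℝ≥0∞).toReal) ξ (s.map j)
        simpa using this)

/-- The compression of an operator on `ℓ²(κ)` to `ℓ²(ι)`, for `ι` regarded as a subset of `κ`
through the injection `j`: if `P` is the orthogonal projection onto `ℓ²(ι)`, this is `P T P`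
regarded as an operator on `ℓ²(ι)`. -/
def compress {ι κ : Type} (j : ι ↪ κ) : Op κ →ₗ[ℂ] Op ι where
  toFun T := restr j ∘L T ∘L (restr j).adjoint
  map_add' S T := by ext; simp
  map_smul' c T := by ext; simp

section multiplication
variable {X ι : Type} [TopologicalSpace X] [CompactSpace X] [MeasurableSpace X] [BorelSpace X]
  {μ : MeasureTheory.Measure X} [MeasureTheory.IsFiniteMeasure μ]

/-- Multiplication by the continuous function `f` on `L²(X, μ)`. -/
def mulL2 (μ : MeasureTheory.Measure X) [MeasureTheory.IsFiniteMeasure μ] (f : C(X, ℂ)) :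
    MeasureTheory.Lp ℂ 2 μ →L[ℂ] MeasureTheory.Lp ℂ 2 μ :=
  (ContinuousLinearMap.mul ℂ ℂ).holderL μ ∞ 2 2 (ContinuousMap.toLp ∞ μ ℂ f)

/-- The multiplication operator by `f`, written in an orthonormal basis of `L²(X, μ)`. -/
def mulOp (b : HilbertBasis ι ℂ (MeasureTheory.Lp ℂ 2 μ)) (f : C(X, ℂ)) : Op ι :=
  (b.repr : MeasureTheory.Lp ℂ 2 μ →L[ℂ] L2 ι) ∘L mulL2 μ f ∘L
    (b.repr.symm : L2 ι →L[ℂ] MeasureTheory.Lp ℂ 2 μ)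

theorem mulOp_apply (b : HilbertBasis ι ℂ (MeasureTheory.Lp ℂ 2 μ)) (f : C(X, ℂ)) (ξ : L2 ι) :
    mulOp b f ξ = b.repr (mulL2 μ f (b.repr.symm ξ)) := rfl

theorem coeFn_mulL2 (f : C(X, ℂ)) (ξ : MeasureTheory.Lp ℂ 2 μ) :
    mulL2 μ f ξ =ᵐ[μ] fun x => f x * ξ x := by
  have h1 := ContinuousLinearMap.coeFn_holder (r := 2) (ContinuousLinearMap.mul ℂ ℂ)
    (ContinuousMap.toLp ∞ μ ℂ f) ξ
  filter_upwards [h1, ContinuousMap.coeFn_toLp (p := ∞) (𝕜 := ℂ) μ f] with x h2 h3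
  rw [h3] at h2
  exact h2

end multiplication

/-- The multiplication operator `M_f` on `ℓ²(ℤ)` generated by `f ∈ C(𝕋)`: multiplication by `f`
on `L²(𝕋)` under the Fourier isomorphism `z ^ m ↔ δ_m`. -/
def mulCircle (f : C(Circle, ℂ)) : Op ℤ :=
  mulOp (fourierBasis (T := (1 : ℝ)))
    (f.comp ⟨AddCircle.toCircle, AddCircle.continuous_toCircle⟩)

/-- The multiplication operator `M_f` on `ℓ²(ℤⁿ)` generated by `f ∈ C(𝕋ⁿ)`. -/
def mulTorus {n : ℕ} (f : C(Fin n → Circle, ℂ)) : Op (Fin n → ℤ) :=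
  mulOp (μ := MeasureTheory.Measure.pi fun _ => AddCircle.haarAddCircle)
    (UnitAddTorus.mFourierBasis (d := Fin n))
    (f.comp ⟨fun x i => AddCircle.toCircle (x i),
      continuous_pi fun i => AddCircle.continuous_toCircle.comp (continuous_apply i)⟩)

/-- For `s ⊆ ℤ`, the compression `P_s M_f P_s` to `ℓ²(s)`. For `s = ℤ` this is `M_f`;
for `s = ℤ_{≥ 0}` it is the Toeplitz operator with symbol `f`. -/
def toep (s : Set ℤ) (f : C(Circle, ℂ)) : Op s :=
  compress (Function.Embedding.subtype (· ∈ s)) (mulCircle f)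

/-- The `C*`-algebra generated by the operators `P_s M_f P_s`: the Toeplitz algebra `𝓣` for
`s = ℤ_{≥ 0}`, and `C(𝕋)`, faithfully represented on `ℓ²(ℤ)` by `f ↦ M_f`, for `s = ℤ`. -/
abbrev toepAlg (s : Set ℤ) : StarSubalgebra ℂ (Op s) := cstarGen (Set.range (toep s))

/-- The line through `x` in direction `i`: `t ↦ (x_1, …, x_{i-1}, t, x_{i+1}, …, x_n)`. -/
def lineEmb {n : ℕ} {K : Fin n → Type} (i : Fin n) (x : ∀ j, K j) : K i ↪ ∀ j, K j :=
  ⟨fun t => Function.update x i t, Function.update_injective x i⟩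

theorem summable_sq {ι : Type} (ξ : L2 ι) : Summable fun i => ‖ξ i‖ ^ 2 := by
  simpa using (memℓp_gen_iff (by norm_num : 0 < (2 : ℝ≥0∞).toReal)).1 (lp.memℓp ξ)

theorem tsum_sq {ι : Type} (ξ : L2 ι) : ∑' i, ‖ξ i‖ ^ 2 = ‖ξ‖ ^ 2 := by
  simpa using (lp.norm_rpow_eq_tsum (by norm_num : 0 < (2 : ℝ≥0∞).toReal) ξ).symm

theorem tsum_enorm_sq {ι : Type} (ξ : L2 ι) : ∑' i, ‖ξ i‖ₑ ^ 2 = ‖ξ‖ₑ ^ 2 := by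
  have := ENNReal.ofReal_tsum_of_nonneg (fun i => sq_nonneg ‖ξ i‖) (summable_sq ξ)
  rw [tsum_sq, ENNReal.ofReal_pow (norm_nonneg _), ofReal_norm] at this
  rw [this]
  refine tsum_congr fun i => ?_
  rw [ENNReal.ofReal_pow (norm_nonneg _), ofReal_norm]

theorem memℓp_of_enorm {ι : Type} {f : ι → ℂ} (h : ∑' i, ‖f i‖ₑ ^ 2 ≠ ∞) : Memℓp f 2 := by
  refine (memℓp_gen_iff (by norm_num)).2 ?_
  have := ENNReal.summable_toReal h
  simpa [ENNReal.toReal_pow] using this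

theorem restr_apply {ι κ : Type} (j : ι ↪ κ) (ξ : L2 κ) (i : ι) : restr j ξ i = ξ (j i) := rfl

theorem ampl_sum {n : ℕ} {K : Fin n → Type} (i : Fin n) (a : Op (K i)) (ξ : L2 (∀ j, K j)) :
    ∑' x : ∀ j, K j, ‖a (restr (lineEmb i x) ξ) (x i)‖ₑ ^ 2 ≤ (‖a‖ₑ * ‖ξ‖ₑ) ^ 2 := by
  classical
  let e := Equiv.piSplitAt i K
  have key : ∀ (t u : K i) (y : ∀ j : {j // j ≠ i}, K j),
      lineEmb i (e.symm (t, y)) u = e.symm (u, y) := by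
    intro t u y
    funext j
    by_cases hj : j = i
    · subst hj; simp [lineEmb, e]
    · simp [lineEmb, e, hj]
  have hi : ∀ (t : K i) (y : ∀ j : {j // j ≠ i}, K j), e.symm (t, y) i = t := by
    intro t y; simp [e]
  have hl : ∀ y : (∀ j : {j // j ≠ i}, K j), ∃ η : L2 (K i),
      (∀ t, restr (lineEmb i (e.symm (t, y))) ξ = η) ∧ ∀ u, η u = ξ (e.symm (u, y)) := by
    intro y
    refine ⟨restr ⟨fun u => e.symm (u, y), fun u v h => by simpa using h⟩ ξ, fun t => ?_,
      fun u => rfl⟩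
    ext u
    simp only [restr_apply, key]; rfl
  choose η h1 h2 using hl
  rw [← e.symm.tsum_eq, ENNReal.tsum_prod', ENNReal.tsum_comm]
  calc _ = ∑' y, ‖a (η y)‖ₑ ^ 2 := by
        refine tsum_congr fun y => ?_
        rw [← tsum_enorm_sq]
        refine tsum_congr fun t => ?_
        rw [h1, hi]
    _ ≤ ∑' y, (‖a‖ₑ * ‖η y‖ₑ) ^ 2 := by
        refine ENNReal.tsum_le_tsum fun y => ?_
        gcongr
        exact a.le_opENorm _
    _ = ‖a‖ₑ ^ 2 * ∑' y, ∑' u, ‖ξ (e.symm (u, y))‖ₑ ^ 2 := by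
        simp_rw [mul_pow]
        rw [ENNReal.tsum_mul_left]
        congr 1
        refine tsum_congr fun y => ?_
        rw [← tsum_enorm_sq]
        exact tsum_congr fun u => by rw [h2]
    _ = _ := by
        rw [ENNReal.tsum_comm, ← ENNReal.tsum_prod (f := fun u y => ‖ξ (e.symm (u, y))‖ₑ ^ 2),
          e.symm.tsum_eq (fun x => ‖ξ x‖ₑ ^ 2), tsum_enorm_sq, mul_pow]

/-- The operator `1 ⊗ ⋯ ⊗ a ⊗ ⋯ ⊗ 1` (with `a` in position `i`) on
`ℓ²(K 1 × ⋯ × K n) = ℓ²(K 1) ⊗ ⋯ ⊗ ℓ²(K n)`: `a` acts along each line in direction `i`. -/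
def ampl {n : ℕ} {K : Fin n → Type} (i : Fin n) (a : Op (K i)) : Op (∀ j, K j) :=
  LinearMap.mkContinuous
    { toFun := fun ξ => ⟨fun x => a (restr (lineEmb i x) ξ) (x i),
        memℓp_of_enorm (ne_top_of_le_ne_top (by finiteness) (ampl_sum i a ξ))⟩
      map_add' := fun ξ η => by
        ext x
        have h : a (restr (lineEmb i x) (ξ + η)) =
            a (restr (lineEmb i x) ξ) + a (restr (lineEmb i x) η) := by rw [map_add, map_add]
        exact congrArg (fun v : L2 (K i) => v (x i)) h
      map_smul' := fun c ξ => by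
        ext x
        have h : a (restr (lineEmb i x) (c • ξ)) = c • a (restr (lineEmb i x) ξ) := by
          rw [map_smul, map_smul]
        exact congrArg (fun v : L2 (K i) => v (x i)) h } ‖a‖ (fun ξ => by
        have h := ampl_sum i a ξ
        have h2 := tsum_enorm_sq (⟨fun x => a (restr (lineEmb i x) ξ) (x i),
          memℓp_of_enorm (ne_top_of_le_ne_top (by finiteness) h)⟩ : L2 (∀ j, K j))
        simp only at h2
        rw [h2] at h
        have h3 := (ENNReal.pow_le_pow_left_iff two_ne_zero).1 h
        have h4 := ENNReal.toReal_mono (by finiteness) h3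
        rwa [ENNReal.toReal_mul, toReal_enorm, toReal_enorm, toReal_enorm] at h4)

theorem ampl_apply {n : ℕ} {K : Fin n → Type} (i : Fin n) (a : Op (K i)) (ξ : L2 (∀ j, K j))
    (x : ∀ j, K j) : ampl i a ξ x = a (restr (lineEmb i x) ξ) (x i) := rfl

open Classical in
/-- The standard basis vector `δ_i`. -/
def dl {ι : Type} (i : ι) : L2 ι := lp.single 2 i (1 : ℂ)

open Classical in
theorem dl_apply {ι : Type} (i j : ι) : dl i j = if j = i then 1 else 0 := by
  simp [dl, Pi.single_apply]

theorem dl_self {ι : Type} (i : ι) : dl i i = 1 := by simp [dl_apply]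

theorem dl_ne {ι : Type} {i j : ι} (h : j ≠ i) : dl i j = 0 := by simp [dl_apply, h]

theorem dl_emb {ι κ : Type} (j : ι ↪ κ) (i k : ι) : dl (j i) (j k) = dl i k := by
  by_cases h : k = i
  · subst h; rw [dl_self, dl_self]
  · rw [dl_ne h, dl_ne (fun h' => h (j.injective h'))]

theorem inner_dl {ι : Type} (i : ι) (ξ : L2 ι) : inner ℂ (dl i) ξ = ξ i := by
  simp [dl, lp.inner_single_left]

theorem restr_norm_le {ι κ : Type} (j : ι ↪ κ) : ‖restr j‖ ≤ 1 :=
  LinearMap.mkContinuous_norm_le _ zero_le_one _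

theorem ext_apply {ι κ : Type} (j : ι ↪ κ) (ξ : L2 ι) (i : ι) :
    (restr j).adjoint ξ (j i) = ξ i := by
  rw [← inner_dl, ContinuousLinearMap.adjoint_inner_right, ← inner_dl]
  congr 1
  ext k
  exact (dl_emb j i k)

theorem ext_apply_not {ι κ : Type} (j : ι ↪ κ) (ξ : L2 ι) (k : κ) (h : ∀ i, j i ≠ k) :
    (restr j).adjoint ξ k = 0 := by
  rw [← inner_dl, ContinuousLinearMap.adjoint_inner_right]
  have : restr j (dl k) = 0 := by
    ext i
    simp [restr_apply, dl_apply, h]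
  rw [this, inner_zero_left]

theorem restr_dl {ι κ : Type} (j : ι ↪ κ) (i : ι) : restr j (dl (j i)) = dl i := by
  ext k
  exact dl_emb j _ _

theorem restr_dl_not {ι κ : Type} (j : ι ↪ κ) (k : κ) (h : ∀ i, j i ≠ k) :
    restr j (dl k) = 0 := by
  ext i
  simp [restr_apply, dl_apply, h]

theorem ext_dl {ι κ : Type} (j : ι ↪ κ) (i : ι) : (restr j).adjoint (dl i) = dl (j i) := by
  ext k
  by_cases h : ∃ m, j m = k
  · obtain ⟨m, rfl⟩ := h
    rw [ext_apply, dl_emb]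
  · rw [ext_apply_not j _ k (fun i hi => h ⟨i, hi⟩), dl_apply, if_neg]
    exact fun hk => h ⟨i, hk.symm⟩

theorem norm_ext {ι κ : Type} (j : ι ↪ κ) (ξ : L2 ι) : ‖(restr j).adjoint ξ‖ = ‖ξ‖ := by
  have : restr j ((restr j).adjoint ξ) = ξ := by
    ext i
    rw [restr_apply, ext_apply]
  rw [← sq_eq_sq₀ (norm_nonneg _) (norm_nonneg _), ← ContinuousLinearMap.adjoint_adjoint (restr j),
    ContinuousLinearMap.adjoint_adjoint, ← inner_self_eq_norm_sq (𝕜 := ℂ),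
    ContinuousLinearMap.adjoint_inner_left, this, inner_self_eq_norm_sq]

theorem adjoint_dl {σ τ : Type} (T : L2 τ →L[ℂ] L2 σ) (x : σ) (y : τ) :
    T.adjoint (dl x) y = conj (T (dl y) x) := by
  rw [← inner_dl, ContinuousLinearMap.adjoint_inner_right, ← inner_dl, inner_conj_symm]

theorem dl_induction {ι : Type} (S : Submodule ℂ (L2 ι)) (hS : IsClosed (S : Set (L2 ι)))
    (h : ∀ i, dl i ∈ S) (ξ : L2 ι) : ξ ∈ S := by
  classical
  have h1 := lp.hasSum_single (p := 2) (by norm_num) ξ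
  refine hS.mem_of_tendsto h1 (Eventually.of_forall fun s => ?_)
  refine S.sum_mem fun i _ => ?_
  have : lp.single (E := fun _ : ι => ℂ) 2 i (ξ i) = ξ i • dl i := by
    ext j
    by_cases hj : j = i
    · subst hj; simp [dl_apply]
    · simp [dl_apply, hj]
  rw [this]
  exact S.smul_mem _ (h i)

theorem tendsto_of_dl {σ τ : Type} (A : ℕ → L2 τ →L[ℂ] L2 σ) (C : ℝ) (hC : ∀ k, ‖A k‖ ≤ C)
    (h : ∀ x, Tendsto (fun k => A k (dl x)) atTop (𝓝 0)) (ξ : L2 τ) :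
    Tendsto (fun k => A k ξ) atTop (𝓝 0) := by
  let S : Submodule ℂ (L2 τ) :=
    { carrier := {v | Tendsto (fun k => A k v) atTop (𝓝 0)}
      add_mem' := fun {a b} ha hb => by simpa using Tendsto.add ha hb
      zero_mem' := by simp
      smul_mem' := fun c a ha => by simpa using Tendsto.const_smul ha c }
  exact dl_induction S (isClosed_tendsto (fun k => (A k : L2 τ →ₗ[ℂ] L2 σ)) C
    (fun k v => (A k).le_of_opNorm_le (hC k) v)) h ξ

theorem op_ext {σ τ : Type} {S T : L2 τ →L[ℂ] L2 σ} (h : ∀ x y, S (dl x) y = T (dl x) y) :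
    S = T := by
  ext1 ξ
  refine dl_induction (LinearMap.eqLocus (S : L2 τ →ₗ[ℂ] L2 σ) T)
    (isClosed_eq S.continuous T.continuous) (fun i => ?_) ξ
  exact lp.ext (funext (h i))

section window
variable {σ τ κ : Type}

/-- The operator `δ_x ↦ δ_y` if `q y = p x` (and `δ_x ↦ 0` if there is no such `y`). -/
def win (q : σ ↪ κ) (p : τ ↪ κ) : L2 τ →L[ℂ] L2 σ := restr q ∘L (restr p).adjoint

theorem win_apply_eq (q : σ ↪ κ) (p : τ ↪ κ) {x : τ} {y : σ} (h : q y = p x) (ξ : L2 τ) :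
    win q p ξ y = ξ x := by
  change (restr p).adjoint ξ (q y) = ξ x
  rw [h, ext_apply]

theorem win_apply_not (q : σ ↪ κ) (p : τ ↪ κ) {y : σ} (h : ∀ x, p x ≠ q y) (ξ : L2 τ) :
    win q p ξ y = 0 := ext_apply_not p ξ _ h

theorem win_dl (q : σ ↪ κ) (p : τ ↪ κ) {x : τ} {y : σ} (h : q y = p x) :
    win q p (dl x) = dl y := by
  change restr q ((restr p).adjoint (dl x)) = dl y
  rw [ext_dl, ← h, restr_dl]

theorem adjoint_win (q : σ ↪ κ) (p : τ ↪ κ) : (win q p).adjoint = win p q := by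
  rw [win, ContinuousLinearMap.adjoint_comp, ContinuousLinearMap.adjoint_adjoint, win]

theorem norm_win (q : σ ↪ κ) (p : τ ↪ κ) : ‖win q p‖ ≤ 1 := by
  refine (ContinuousLinearMap.opNorm_comp_le _ _).trans ?_
  rw [LinearIsometryEquiv.norm_map]
  exact mul_le_one₀ (restr_norm_le q) (norm_nonneg _) (restr_norm_le p)

theorem adm_win (q : ℕ → σ ↪ κ) (p : τ ↪ κ) (h : ∀ x, ∀ᶠ k in atTop, ∃ y, q k y = p x) :
    Adm fun k => win (q k) p := by
  refine ⟨fun k => norm_win _ _, fun ξ => ?_⟩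
  have h1 := tendsto_of_dl (fun k => win p (q k) ∘L win (q k) p - ContinuousLinearMap.id ℂ _) 2
    (fun k => ?_) (fun x => ?_) ξ
  · have := h1.add_const ξ
    rw [zero_add] at this
    refine this.congr fun k => ?_
    rw [adjoint_win]
    simp
  · refine (norm_sub_le _ _).trans ?_
    have a := ContinuousLinearMap.opNorm_comp_le (win p (q k)) (win (q k) p)
    have b := mul_le_one₀ (norm_win p (q k)) (norm_nonneg _) (norm_win (q k) p)
    have c := ContinuousLinearMap.norm_id_le (𝕜 := ℂ) (E := L2 τ)
    linarith
  · refine tendsto_const_nhds.congr' ?_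
    filter_upwards [h x] with k hk
    obtain ⟨y, hy⟩ := hk
    have e : win p (q k) (win (q k) p (dl x)) = dl x := by
      rw [win_dl (q k) p hy, win_dl p (q k) hy.symm]
    change (0 : L2 τ) = win p (q k) (win (q k) p (dl x)) - dl x
    rw [e, sub_self]

theorem asymp_of_dl {W : ℕ → L2 τ →L[ℂ] L2 σ} (hW : ∀ k, ‖W k‖ ≤ 1) {a : Op σ} {b : Op τ}
    (h : ∀ x, Tendsto (fun k => a (W k (dl x)) - W k (b (dl x))) atTop (𝓝 0))
    (h' : ∀ x, Tendsto (fun k => (star a) (W k (dl x)) - W k ((star b) (dl x))) atTop (𝓝 0)) :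
    (a, b) ∈ asymp W := by
  have key : ∀ (a : Op σ) (b : Op τ),
      (∀ x, Tendsto (fun k => a (W k (dl x)) - W k (b (dl x))) atTop (𝓝 0)) → ∀ ξ,
      Tendsto (fun k => a (W k ξ) - W k (b ξ)) atTop (𝓝 0) := by
    intro a b hab ξ
    refine tendsto_of_dl (fun k => a ∘L W k - W k ∘L b) (‖a‖ + ‖b‖) (fun k => ?_) hab ξ
    refine (norm_sub_le _ _).trans (add_le_add ?_ ?_)
    · refine (ContinuousLinearMap.opNorm_comp_le _ _).trans ?_
      exact mul_le_of_le_one_right (norm_nonneg _) (hW k)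
    · refine (ContinuousLinearMap.opNorm_comp_le _ _).trans ?_
      exact mul_le_of_le_one_left (norm_nonneg _) (hW k)
  exact fun ξ => ⟨key a b h ξ, key _ _ h' ξ⟩

end window

/-- The matrix of `M` is constant along diagonals. -/
def Laur (M : Op ℤ) : Prop := ∀ x y c, M (dl (x + c)) (y + c) = M (dl x) y

theorem Laur.star {M : Op ℤ} (h : Laur M) : Laur (star M) := by
  intro x y c
  rw [ContinuousLinearMap.star_eq_adjoint, adjoint_dl, adjoint_dl, h]

theorem laur_mulCircle (f : C(Circle, ℂ)) : Laur (mulCircle f) := by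
  have key : ∀ x y : ℤ, mulCircle f (dl x) y =
      ∫ t : AddCircle (1 : ℝ), fourier (x - y) t * f (AddCircle.toCircle t)
        ∂AddCircle.haarAddCircle := by
    intro x y
    have e : (fourierBasis (T := (1 : ℝ))).repr.symm (dl x) = fourierLp 2 x := by
      have h1 : (dl x : L2 ℤ) = lp.single 2 x (1 : ℂ) := by
        ext j
        simp [dl_apply, Pi.single_apply]
      rw [h1, HilbertBasis.repr_symm_single, coe_fourierBasis]
    rw [mulCircle, mulOp_apply, e, fourierBasis_repr, fourierCoeff]
    refine MeasureTheory.integral_congr_ae ?_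
    filter_upwards [coeFn_mulL2 (μ := AddCircle.haarAddCircle)
      (f.comp ⟨AddCircle.toCircle, AddCircle.continuous_toCircle⟩ : C(AddCircle (1 : ℝ), ℂ))
      (fourierLp 2 x), coeFn_fourierLp (T := (1 : ℝ)) 2 x] with t h1 h2
    have h4 : mulL2 AddCircle.haarAddCircle
      (f.comp ⟨AddCircle.toCircle, AddCircle.continuous_toCircle⟩ : C(AddCircle (1 : ℝ), ℂ))
      (fourierLp 2 x) t = f (AddCircle.toCircle t) * fourier x t := by
      rw [h1, h2]
      rfl
    rw [h4, smul_eq_mul, sub_eq_add_neg, fourier_add]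
    ring
  intro x y c
  rw [key, key]
  simp

theorem compress_apply {ι κ : Type} (j : ι ↪ κ) (T : Op κ) (i k : ι) :
    compress j T (dl i) k = T (dl (j i)) (j k) := by
  change T ((restr j).adjoint (dl i)) (j k) = _
  rw [ext_dl]

theorem star_compress {ι κ : Type} (j : ι ↪ κ) (T : Op κ) :
    star (compress j T) = compress j (star T) := by
  refine op_ext fun x y => ?_
  rw [ContinuousLinearMap.star_eq_adjoint, ContinuousLinearMap.star_eq_adjoint, adjoint_dl,
    compress_apply, compress_apply, adjoint_dl]

/-- `y ↦ y - c` on `s`. -/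
def shiftEmb (s : Set ℤ) (c : ℤ) : s ↪ ℤ :=
  ⟨fun y => y - c, fun y z h => Subtype.ext (by simpa using h)⟩

theorem shiftEmb_apply (s : Set ℤ) (c : ℤ) (y : s) : shiftEmb s c y = (y : ℤ) - c := rfl

theorem shiftEmb_mk (s t : Set ℤ) (c : ℤ) (x : t) (h : (x : ℤ) + c ∈ s) :
    shiftEmb s c ⟨x + c, h⟩ = Function.Embedding.subtype (· ∈ t) x := by
  rw [shiftEmb_apply, Function.Embedding.coe_subtype, add_sub_cancel_right]

/-- The translates `s - c_k` are contained in `t` and converge to `t` pointwise. -/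
def Step (s t : Set ℤ) (c : ℕ → ℤ) : Prop :=
  (∀ x ∈ t, ∀ᶠ k in atTop, x + c k ∈ s) ∧ ∀ k, ∀ y ∈ s, y - c k ∈ t

theorem Step.adm {s t : Set ℤ} {c : ℕ → ℤ} (h : Step s t c) :
    Adm fun k => win (shiftEmb s (c k)) (Function.Embedding.subtype (· ∈ t)) := by
  refine adm_win _ _ fun x => ?_
  filter_upwards [h.1 x x.2] with k hk
  exact ⟨⟨_, hk⟩, shiftEmb_mk s t (c k) x hk⟩

theorem Step.asymp {s t : Set ℤ} {c : ℕ → ℤ} (h : Step s t c) (f : C(Circle, ℂ)) :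
    (toep s f, toep t f) ∈
      asymp fun k => win (shiftEmb s (c k)) (Function.Embedding.subtype (· ∈ t)) := by
  have key : ∀ M, Laur M → ∀ x, Tendsto (fun k => compress (Function.Embedding.subtype (· ∈ s)) M
      (win (shiftEmb s (c k)) (Function.Embedding.subtype (· ∈ t)) (dl x)) -
      win (shiftEmb s (c k)) (Function.Embedding.subtype (· ∈ t))
        (compress (Function.Embedding.subtype (· ∈ t)) M (dl x))) atTop (𝓝 0) := by
    intro M hM x
    refine tendsto_const_nhds.congr' ?_
    filter_upwards [h.1 x x.2] with k hk
    rw [win_dl _ _ (y := ⟨_, hk⟩) (shiftEmb_mk s t (c k) x hk)]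
    symm
    rw [sub_eq_zero]
    ext y
    have e1 := win_apply_eq (shiftEmb s (c k)) (Function.Embedding.subtype (· ∈ t))
      (x := ⟨_, h.2 k y y.2⟩) (y := y) rfl
      (compress (Function.Embedding.subtype (· ∈ t)) M (dl x))
    refine Eq.trans ?_ e1.symm
    rw [compress_apply, compress_apply]
    have e2 := hM x (y - c k) (c k)
    rw [sub_add_cancel] at e2
    exact e2
  refine asymp_of_dl (fun k => norm_win _ _) (key _ (laur_mulCircle f)) ?_
  rw [toep, toep, star_compress, star_compress]
  exact key _ (laur_mulCircle f).star

variable {n : ℕ}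

/-- The `i`-th factor of the index set `∏ i, side A i`: all of `ℤ` for `i ∈ A`, and `ℤ_{≥ 0}`
otherwise. -/
def side (A : Finset (Fin n)) (i : Fin n) : Set ℤ := if i ∈ A then Set.univ else Set.Ici 0

/-- The translation by `k` in the directions `R \ D`, used to construct `π^D_R`. -/
def stepSeq (D R : Finset (Fin n)) (i : Fin n) (k : ℕ) : ℤ := if i ∈ R \ D then k else 0

theorem step_side {D R : Finset (Fin n)} (h : D ⊆ R) (i : Fin n) :
    Step (side D i) (side R i) (stepSeq D R i) := by
  by_cases hR : i ∈ R
  · by_cases hD : i ∈ D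
    · constructor <;> simp [side, stepSeq, hR, hD]
    · constructor
      · intro x _
        filter_upwards [eventually_ge_atTop x.natAbs] with k hk
        simp only [side, stepSeq, hD, hR, Finset.mem_sdiff, if_true, if_false, not_false_eq_true,
          and_self, Set.mem_Ici]
        omega
      · simp [side, hR]
  · have hD : i ∉ D := fun h' => hR (h h')
    constructor
    · intro x hx
      exact Eventually.of_forall fun k => by simpa [side, stepSeq, hR, hD] using hx
    · simp [side, stepSeq, hR, hD]

theorem existsUnique_symb {D R : Finset (Fin n)} (h : D ⊆ R) (i : Fin n) :
    ∃! φ : toepAlg (side D i) →⋆ₐ[ℂ] toepAlg (side R i),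
      ∀ f, φ (genElem (toep (side D i)) f) = genElem (toep (side R i)) f := by
  exact existsUnique_hom (step_side h i).adm _ _ id (step_side h i).asymp

/-- The unique `*`-homomorphism sending `P_s M_f P_s` to `P_t M_f P_t`, where `s = side D i` and
`t = side R i`. It is `γ : 𝓣 → C(𝕋)`, `T_f ↦ f`, when `i ∈ R \ D`, and the identity otherwise. -/
def symb {D R : Finset (Fin n)} (h : D ⊆ R) (i : Fin n) :
    toepAlg (side D i) →⋆ₐ[ℂ] toepAlg (side R i) := (existsUnique_symb h i).choose

theorem symb_gen {D R : Finset (Fin n)} (h : D ⊆ R) (i : Fin n) (f : C(Circle, ℂ)) :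
    symb h i (genElem (toep (side D i)) f) = genElem (toep (side R i)) f :=
  (existsUnique_symb h i).choose_spec.1 f

theorem symb_asymp {D R : Finset (Fin n)} (h : D ⊆ R) (i : Fin n) (a : toepAlg (side D i)) :
    ((a : Op (side D i)), (symb h i a : Op (side R i))) ∈
      asymp fun k => win (shiftEmb (side D i) (stepSeq D R i k))
        (Function.Embedding.subtype (· ∈ side R i)) := by
  exact hom_asymp (step_side h i).adm _ _ id (step_side h i).asymp _ (symb_gen h i) a

section lines
variable {K : Fin n → Type} (i : Fin n)

theorem line_self (x : ∀ j, K j) : lineEmb i x (x i) = x := Function.update_eq_self i x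

theorem line_same (x : ∀ j, K j) (t : K i) : lineEmb i x t i = t := Function.update_self ..

theorem line_ne (x : ∀ j, K j) (t : K i) {j : Fin n} (h : j ≠ i) : lineEmb i x t j = x j :=
  Function.update_of_ne h ..

theorem line_eq {x y : ∀ j, K j} (h : ∀ j, j ≠ i → x j = y j) : lineEmb i x (y i) = y := by
  funext j
  by_cases hj : j = i
  · subst hj; exact line_same _ _ _
  · rw [line_ne i x _ hj, h j hj]

theorem ampl_dl_apply (a : Op (K i)) {x y : ∀ j, K j} (h : ∀ j, j ≠ i → x j = y j) :
    ampl i a (dl y) x = a (dl (y i)) (x i) := by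
  have := restr_dl (lineEmb i x) (y i)
  rw [line_eq i h] at this
  rw [ampl_apply, this]

theorem ampl_dl_apply_not (a : Op (K i)) {x y : ∀ j, K j} (h : ¬ ∀ j, j ≠ i → x j = y j) :
    ampl i a (dl y) x = 0 := by
  rw [ampl_apply, restr_dl_not, map_zero]
  · rfl
  · rintro t rfl
    exact h fun j hj => (line_ne i x t hj).symm

theorem star_ampl (a : Op (K i)) : star (ampl i a) = ampl i (star a) := by
  refine op_ext fun x y => ?_
  rw [ContinuousLinearMap.star_eq_adjoint, ContinuousLinearMap.star_eq_adjoint, adjoint_dl]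
  by_cases h : ∀ j, j ≠ i → x j = y j
  · rw [ampl_dl_apply i _ h, ampl_dl_apply i _ (fun j hj => (h j hj).symm), adjoint_dl]
  · rw [ampl_dl_apply_not i _ h, ampl_dl_apply_not i _ (fun h' => h fun j hj => (h' j hj).symm),
      map_zero]

theorem ampl_dl (a : Op (K i)) (y : ∀ j, K j) :
    ampl i a (dl y) = (restr (lineEmb i y)).adjoint (a (dl (y i))) := by
  ext x
  by_cases h : ∀ j, j ≠ i → x j = y j
  · rw [ampl_dl_apply i _ h]
    conv_rhs => rw [← line_eq i (fun j hj => (h j hj).symm)]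
    rw [ext_apply]
  · rw [ampl_dl_apply_not i _ h, ext_apply_not]
    rintro t rfl
    exact h fun j hj => line_ne i y t hj

end lines

/-- `ℤⁿ ⊇ ∏ i, side A i`, i.e. the set of `x ∈ ℤⁿ` with `x i ≥ 0` for all `i ∉ A`. -/
abbrev Box (A : Finset (Fin n)) : Type := ∀ i, side A i

/-- `x ↦ x - c` on `∏ i, side A i`. -/
def boxShift (A : Finset (Fin n)) (c : Fin n → ℤ) : Box A ↪ (Fin n → ℤ) :=
  ⟨fun x i => x i - c i, fun _ _ h => funext fun i => Subtype.ext (by simpa using congrFun h i)⟩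

/-- The inclusion of `∏ i, side A i` in `ℤⁿ`. -/
def boxEmb (A : Finset (Fin n)) : Box A ↪ (Fin n → ℤ) :=
  ⟨fun x i => x i, fun _ _ h => funext fun i => Subtype.ext (congrFun h i)⟩

/-- The window operators `ℓ²(Box R) → ℓ²(Box D)`: translation by `k` in the directions `R \ D`. -/
def boxWin (D R : Finset (Fin n)) (k : ℕ) : L2 (Box R) →L[ℂ] L2 (Box D) :=
  win (boxShift D fun i => stepSeq D R i k) (boxEmb R)

theorem boxWin_ev {D R : Finset (Fin n)} (h : D ⊆ R) (x : Box R) :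
    ∀ᶠ k in atTop, ∃ y : Box D, ∀ i, (y i : ℤ) - stepSeq D R i k = x i := by
  have : ∀ i, ∀ᶠ k in atTop, (x i : ℤ) + stepSeq D R i k ∈ side D i :=
    fun i => (step_side h i).1 _ (x i).2
  filter_upwards [eventually_all.2 this] with k hk
  exact ⟨fun i => ⟨_, hk i⟩, fun i => by simp⟩

theorem boxWin_adm {D R : Finset (Fin n)} (h : D ⊆ R) : Adm (boxWin D R) := by
  refine adm_win _ _ fun x => ?_
  filter_upwards [boxWin_ev h x] with k hk
  obtain ⟨y, hy⟩ := hk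
  exact ⟨y, funext hy⟩

theorem boxWin_line {D R : Finset (Fin n)} (i : Fin n) (k : ℕ) {x : Box R} {y : Box D}
    (h : ∀ i, (y i : ℤ) - stepSeq D R i k = x i) (η : L2 (side R i)) :
    boxWin D R k ((restr (lineEmb i x)).adjoint η) =
      (restr (lineEmb i y)).adjoint (win (shiftEmb (side D i) (stepSeq D R i k))
        (Function.Embedding.subtype (· ∈ side R i)) η) := by
  ext z
  by_cases hz : ∀ j, j ≠ i → y j = z j
  · have hzl := line_eq i hz
    have hR : (restr (lineEmb i y)).adjoint (win (shiftEmb (side D i) (stepSeq D R i k))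
        (Function.Embedding.subtype (· ∈ side R i)) η) z =
        win (shiftEmb (side D i) (stepSeq D R i k))
        (Function.Embedding.subtype (· ∈ side R i)) η (z i) := by
      conv_lhs => rw [← hzl]
      rw [ext_apply]
    rw [hR]
    by_cases hu : ((z i : ℤ) - stepSeq D R i k) ∈ side R i
    · have e1 : win (shiftEmb (side D i) (stepSeq D R i k))
          (Function.Embedding.subtype (· ∈ side R i)) η (z i) = η ⟨_, hu⟩ :=
        win_apply_eq (shiftEmb (side D i) (stepSeq D R i k))
          (Function.Embedding.subtype (· ∈ side R i)) rfl η
      have e2 : boxShift D (fun i => stepSeq D R i k) z = boxEmb R (lineEmb i x ⟨_, hu⟩) := by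
        funext j
        change (z j : ℤ) - stepSeq D R j k = (lineEmb i x ⟨_, hu⟩ j : ℤ)
        by_cases hj : j = i
        · subst hj; rw [line_same]
        · rw [line_ne _ _ _ hj, ← h j, hz j hj]
      have e3 := win_apply_eq _ _ e2 ((restr (lineEmb i x)).adjoint η)
      rw [ext_apply] at e3
      exact e3.trans e1.symm
    · rw [win_apply_not, boxWin, win_apply_not]
      · intro x' hx'
        apply hu
        have : (x' i : ℤ) = z i - stepSeq D R i k := congrFun hx' i
        rw [← this]
        exact (x' i).2
      · intro u hu'
        apply hu
        have : (u : ℤ) = z i - stepSeq D R i k := hu'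
        rw [← this]
        exact u.2
  · rw [ext_apply_not (lineEmb i y)]
    · by_cases hx : ∃ x' : Box R, boxEmb R x' = boxShift D (fun i => stepSeq D R i k) z
      · obtain ⟨x', hx'⟩ := hx
        rw [boxWin, win_apply_eq _ _ hx'.symm, ext_apply_not]
        rintro t rfl
        apply hz
        intro j hj
        have h1 : ((lineEmb i x t) j : ℤ) = z j - stepSeq D R j k := congrFun hx' j
        rw [line_ne _ _ _ hj, ← h j] at h1
        exact Subtype.ext (by linarith)
      · exact win_apply_not _ _ (fun x' hx' => hx ⟨x', hx'⟩) _
    · rintro t rfl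
      exact hz fun j hj => (line_ne i y t hj).symm

theorem ampl_asymp {D R : Finset (Fin n)} (h : D ⊆ R) (i : Fin n) {a : Op (side D i)}
    {b : Op (side R i)} (hab : (a, b) ∈
      asymp fun k => win (shiftEmb (side D i) (stepSeq D R i k))
        (Function.Embedding.subtype (· ∈ side R i))) :
    ((ampl i a : Op (Box D)), (ampl i b : Op (Box R))) ∈ asymp (boxWin D R) := by
  have key : ∀ (a : Op (side D i)) (b : Op (side R i)), (a, b) ∈
      (asymp fun k => win (shiftEmb (side D i) (stepSeq D R i k))
        (Function.Embedding.subtype (· ∈ side R i))) → ∀ x : Box R,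
      Tendsto (fun k => (ampl i a : Op (Box D)) (boxWin D R k (dl x)) -
        boxWin D R k ((ampl i b : Op (Box R)) (dl x))) atTop (𝓝 0) := by
    intro a b hab x
    have h1 := (hab (dl (x i))).1
    rw [tendsto_zero_iff_norm_tendsto_zero] at h1 ⊢
    refine h1.congr' ?_
    filter_upwards [boxWin_ev h x] with k hk
    obtain ⟨y, hy⟩ := hk
    have e1 : boxWin D R k (dl x) = dl y := win_dl _ _ (funext hy)
    rw [e1, ampl_dl, ampl_dl, boxWin_line i k hy, ← map_sub, norm_ext,
      win_dl _ _ (y := y i) (hy i)]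
  refine asymp_of_dl (boxWin_adm h).1 (key a b hab) ?_
  rw [star_ampl, star_ampl]
  exact key _ _ (asymp_star hab)

/-- `1 ⊗ ⋯ ⊗ a ⊗ ⋯ ⊗ 1` with `a ∈ A_i` in position `i`. -/
def tensOp (A : Finset (Fin n)) (p : Σ i, toepAlg (side A i)) : Op (Box A) :=
  ampl p.1 (p.2 : Op (side A p.1))

/-- The (spatial) `C*`-tensor product `A_1 ⊗ ⋯ ⊗ A_n`, acting on `⨂ i, ℓ²(side A i) = ℓ²(Box A)`,
where `A_i` is `C(𝕋)` for `i ∈ A` and the Toeplitz algebra for `i ∉ A`. It is generated by the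
elements `1 ⊗ ⋯ ⊗ a ⊗ ⋯ ⊗ 1` with `a ∈ A_i`, since
`a_1 ⊗ ⋯ ⊗ a_n` is the product of the elements `1 ⊗ ⋯ ⊗ a_i ⊗ ⋯ ⊗ 1`. -/
abbrev tAlg (A : Finset (Fin n)) : StarSubalgebra ℂ (Op (Box A)) := cstarGen (Set.range (tensOp A))

/-- `γ` or the identity on the generators: `(i, a) ↦ (i, γ a)` if `i ∈ R \ D`, and `(i, a) ↦ (i, a)`
otherwise. -/
def symbIdx {D R : Finset (Fin n)} (h : D ⊆ R) (p : Σ i, toepAlg (side D i)) :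
    Σ i, toepAlg (side R i) := ⟨p.1, symb h p.1 p.2⟩

theorem tensOp_asymp {D R : Finset (Fin n)} (h : D ⊆ R) (p : Σ i, toepAlg (side D i)) :
    (tensOp D p, tensOp R (symbIdx h p)) ∈ asymp (boxWin D R) :=
  ampl_asymp h p.1 (symb_asymp h p.1 p.2)

theorem existsUnique_proj {D R : Finset (Fin n)} (h : D ⊆ R) :
    ∃! φ : tAlg D →⋆ₐ[ℂ] tAlg R,
      ∀ p, φ (genElem (tensOp D) p) = genElem (tensOp R) (symbIdx h p) :=
  existsUnique_hom (boxWin_adm h) (tensOp D) (tensOp R) (symbIdx h) (tensOp_asymp h)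

/-- The `*`-homomorphism `π^D_R = a_1 ⊗ ⋯ ⊗ a_n`, where `a_i` is `γ` for `i ∈ R \ D` and the
identity otherwise: the unique `*`-homomorphism with
`1 ⊗ ⋯ ⊗ a ⊗ ⋯ ⊗ 1 ↦ 1 ⊗ ⋯ ⊗ a_i(a) ⊗ ⋯ ⊗ 1` for all `i` and all `a ∈ A_i`. -/
def proj {D R : Finset (Fin n)} (h : D ⊆ R) : tAlg D →⋆ₐ[ℂ] tAlg R :=
  (existsUnique_proj h).choose

theorem proj_gen {D R : Finset (Fin n)} (h : D ⊆ R) (p : Σ i, toepAlg (side D i)) :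
    proj h (genElem (tensOp D) p) = genElem (tensOp R) (symbIdx h p) :=
  (existsUnique_proj h).choose_spec.1 p

theorem symb_symb {D R Q : Finset (Fin n)} (h : D ⊆ R) (h' : R ⊆ Q) (i : Fin n)
    (a : toepAlg (side D i)) : symb h' i (symb h i a) = symb (h.trans h') i a :=
  hom_comp (e := id) (e' := id) (e'' := id) (symb h i) (symb h' i) (symb (h.trans h') i)
    (symb_gen h i) (symb_gen h' i) (symb_gen (h.trans h') i) (fun _ => rfl) a

theorem proj_proj {D R Q : Finset (Fin n)} (h : D ⊆ R) (h' : R ⊆ Q) (T : tAlg D) :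
    proj h' (proj h T) = proj (h.trans h') T :=
  hom_comp (proj h) (proj h') (proj (h.trans h')) (proj_gen h) (proj_gen h')
    (proj_gen (h.trans h')) (fun p => congrArg (Sigma.mk p.1) (symb_symb h h' p.1 p.2)) T

/-- The compatible tuples `(T_1, …, T_n)`, `T_i ∈ 𝓣ⁿ_{i}`, with
`π^{i}_{ij}(T_i) = π^{j}_{ij}(T_j)` for `i < j`. -/
def sAlg (n : ℕ) : StarSubalgebra ℂ (∀ i : Fin n, tAlg {i}) where
  carrier := {T | ∀ i j, i < j →
    proj (show ({i} : Finset (Fin n)) ⊆ {i, j} by simp) (T i) =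
      proj (show ({j} : Finset (Fin n)) ⊆ {i, j} by simp) (T j)}
  mul_mem' hS hT i j hij := by simp [hS i j hij, hT i j hij]
  add_mem' hS hT i j hij := by simp [hS i j hij, hT i j hij]
  algebraMap_mem' c i j hij := by
    rw [Pi.algebraMap_apply, Pi.algebraMap_apply, AlgHomClass.commutes, AlgHomClass.commutes]
  star_mem' hT i j hij := by simp [map_star, hT i j hij]

/-- `γ_n(T) = (π_1(T), …, π_n(T))`. -/
def gammaN (n : ℕ) : tAlg (∅ : Finset (Fin n)) →⋆ₐ[ℂ] sAlg n where
  toFun T := ⟨fun i => proj (Finset.empty_subset {i}) T, fun i j _ => by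
    rw [proj_proj, proj_proj]⟩
  map_one' := Subtype.ext (funext fun i => map_one _)
  map_zero' := Subtype.ext (funext fun i => map_zero _)
  map_mul' S T := Subtype.ext (funext fun i => map_mul _ S T)
  map_add' S T := Subtype.ext (funext fun i => map_add _ S T)
  map_star' T := Subtype.ext (funext fun i => map_star _ T)
  commutes' c := Subtype.ext (funext fun i => AlgHomClass.commutes _ c)

/-- `T_A = π^i_A(T_i)`, computed with the smallest `i ∈ A`. -/
def face {A : Finset (Fin n)} (hA : A.Nonempty) (T : sAlg n) : tAlg A :=
  proj (Finset.singleton_subset_iff.2 (A.min'_mem hA)) ((T : ∀ i : Fin n, tAlg {i}) (A.min' hA))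

/-- The inclusion of `(ℤ_{≥ 0})ⁿ = Box ∅` in `Box A`. -/
def orthantEmb (A : Finset (Fin n)) : Box (∅ : Finset (Fin n)) ↪ Box A :=
  ⟨fun x i => ⟨x i, by
      by_cases h : i ∈ A
      · simp [side, h]
      · simpa [side, h] using (x i).2⟩,
    fun _ _ h => funext fun i => Subtype.ext (Subtype.mk.inj (congrFun h i))⟩

/-- The `C*`-algebra generated by the operators `P_n M_f P_n` on `ℓ²((ℤ_{≥ 0})ⁿ)`, `f ∈ C(𝕋ⁿ)`,
where `P_n` is the orthogonal projection of `ℓ²(ℤⁿ)` onto `ℓ²((ℤ_{≥ 0})ⁿ)`. -/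
def orthantToeplitz (n : ℕ) : StarSubalgebra ℂ (Op (Box (∅ : Finset (Fin n)))) :=
  cstarGen (Set.range fun f : C(Fin n → Circle, ℂ) => compress (boxEmb ∅) (mulTorus f))

/-- The compact operators on a Hilbert space. -/
def compactOps (H : Type) [NormedAddCommGroup H] [InnerProductSpace ℂ H] [CompleteSpace H] :
    NonUnitalStarSubalgebra ℂ (H →L[ℂ] H) where
  carrier := {T | IsCompactOperator T}
  add_mem' hS hT := hS.add hT
  zero_mem' := isCompactOperator_zero
  mul_mem' {_ T} hS _ := hS.comp_clm T
  smul_mem' c _ hT := hT.smul c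
  star_mem' hT := isCompact_adjoint hT

end OrthantToeplitz

end

open OrthantToeplitz

/-!
Everything rests on the truncated shifts `cutShift A c m` on `ℓ²(Box A)`, which send `δ_x` to
`δ_{x + c}` if `x i ≥ m i` for all `i ∉ A` and `x + c` lies in `Box A`, and to `0` otherwise. Their
linear span is a `*`-algebra generated by the compressed translations, and since the characters
span dense subspaces of `C(𝕋)` and of `C(𝕋ⁿ)`, its closure is the tensor product `tAlg A` and, for
`A = ∅`, also the algebra generated by the Toeplitz operators `P_n M_f P_n` (`tAlg_eq_closure`,
`orthantToeplitz_eq_closure`). Identities between continuous linear maps on `tAlg A` therefore need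
to be checked on truncated shifts only (`eq_of_eq_cutElem`). There `π^D_R` and `ρ_A` are explicit:
`π^D_R` keeps `c` and `m` and forgets the cut-offs in the directions `R \ D` (`proj_cutElem`), and
`ρ_A` replaces `m` by `0` on `A` (`rho_cutElem`). Hence `π_A ρ_A = id` (`proj_rho`), and
`π_j ρ_A = π_j ρ_{A ∪ {j}} π^A_{A ∪ {j}}` (`proj_rho_insert`).

By the last identity, the terms for `A` and `A ∪ {j}` of the alternating sum `ρ'(T)` cancel under
`π_j`, except that `A = {j}` has no partner; what remains is `π_j ρ_{j}(T_j) = T_j`, so `ρ'` splits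
`γ_n` (`gammaN_splitting`), which is thereby surjective.

For the kernel of `γ_n`, consider `Φ(T) = ∑_A (-1)^|A| ρ_A π_A(T)`. It sends a truncated shift to an
operator that kills `δ_x` as soon as `x i ≥ m i` for one `i`, again because the terms cancel in
pairs; this has finite rank, so by density `Φ(T)` is always compact (`isCompactOperator_altSum`). If
`γ_n(T) = 0`, only the term `A = ∅` survives and `Φ(T) = T`, so `T` is compact. Conversely the
compact operators are the closed span of the matrix units (`mem_of_rankOne_mem`); these lie in `𝓣ⁿ`,
the projection onto `δ_0` being `± Φ` of a truncated shift, and they are killed by `γ_n` because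
their translates to infinity converge strongly to `0` (`compact_asymp`).
-/

namespace OrthantToeplitz

variable {n : ℕ}

/-! ### Truncated shifts -/

theorem mem_side {A : Finset (Fin n)} {i : Fin n} {z : ℤ} : z ∈ side A i ↔ (i ∉ A → 0 ≤ z) := by
  by_cases h : i ∈ A <;> simp [side, h]

theorem Box.nonneg {A : Finset (Fin n)} (x : Box A) {i : Fin n} (hi : i ∉ A) : 0 ≤ (x i : ℤ) :=
  mem_side.1 (x i).2 hi

theorem Box.ext_int {A : Finset (Fin n)} {x y : Box A} (h : ∀ i, (x i : ℤ) = y i) : x = y :=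
  funext fun i => Subtype.ext (h i)

/-- The compression to `ℓ²(Box A)` of the translation by `c` on `ℓ²(ℤⁿ)`: `δ_x ↦ δ_{x + c}` if
`x + c` lies in `Box A`, and `δ_x ↦ 0` otherwise. -/
noncomputable def shiftOp (A : Finset (Fin n)) (c : Fin n → ℤ) : Op (Box A) :=
  win (boxShift A c) (boxEmb A)

theorem shiftOp_dl {A : Finset (Fin n)} {c : Fin n → ℤ} {x y : Box A}
    (h : ∀ i, (y i : ℤ) = x i + c i) : shiftOp A c (dl x) = dl y :=
  win_dl _ _ (funext fun i => by
    change (y i : ℤ) - c i = x i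
    rw [h]; ring)

theorem shiftOp_dl_not {A : Finset (Fin n)} {c : Fin n → ℤ} {x : Box A}
    (h : ∃ i, i ∉ A ∧ (x i : ℤ) + c i < 0) : shiftOp A c (dl x) = 0 := by
  obtain ⟨i, hi, hlt⟩ := h
  change restr _ ((restr _).adjoint (dl x)) = 0
  rw [ext_dl]
  refine restr_dl_not _ _ fun y hy => ?_
  have h1 : (y i : ℤ) - c i = x i := congrFun hy i
  have := y.nonneg hi
  linarith

/-- The truncated translation `δ_x ↦ δ_{x + c}` on `ℓ²(Box A)`, where `δ_x` is sent to `0` unless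
`x + c ∈ Box A` and `m i ≤ x i` for all `i ∉ A`. The values of `m` on `A` play no role. These are
the monomials in the shifts of the coordinates and their adjoints. -/
noncomputable def cutShift (A : Finset (Fin n)) (c m : Fin n → ℤ) : Op (Box A) :=
  shiftOp A (c + m) * shiftOp A (-m)

theorem cutShift_dl {A : Finset (Fin n)} {c m : Fin n → ℤ} {x y : Box A}
    (hm : ∀ i, i ∉ A → m i ≤ x i) (h : ∀ i, (y i : ℤ) = x i + c i) :
    cutShift A c m (dl x) = dl y := by
  let z : Box A := fun i => ⟨x i - m i, mem_side.2 fun hi => by linarith [hm i hi]⟩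
  have hz : shiftOp A (-m) (dl x) = dl z := shiftOp_dl fun i => by
    change (x i : ℤ) - m i = x i + -m i
    ring
  rw [cutShift, mul_apply_eq_comp, hz]
  refine shiftOp_dl fun i => ?_
  change (y i : ℤ) = x i - m i + (c i + m i)
  rw [h]; ring

theorem cutShift_dl_not {A : Finset (Fin n)} {c m : Fin n → ℤ} {x : Box A}
    (h : ∃ i, i ∉ A ∧ ((x i : ℤ) < m i ∨ (x i : ℤ) + c i < 0)) :
    cutShift A c m (dl x) = 0 := by
  rw [cutShift, mul_apply_eq_comp]
  by_cases hm : ∃ i, i ∉ A ∧ (x i : ℤ) + (-m) i < 0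
  · rw [shiftOp_dl_not hm, map_zero]
  · push Not at hm
    have hz : shiftOp A (-m) (dl x) =
        dl (fun i => ⟨x i + (-m) i, mem_side.2 fun hi => hm i hi⟩ : Box A) :=
      shiftOp_dl fun i => rfl
    rw [hz]
    obtain ⟨i, hi, h⟩ := h
    have := hm i hi
    simp only [Pi.neg_apply] at this
    refine shiftOp_dl_not ⟨i, hi, ?_⟩
    simp only [Pi.neg_apply, Pi.add_apply]
    rcases h with h | h <;> linarith

/-- Either `cutShift` moves `δ_x` to `δ_{x + c}`, or it kills `δ_x`. -/
theorem cutShift_cases (A : Finset (Fin n)) (c m : Fin n → ℤ) (x : Box A) :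
    (∃ y : Box A, (∀ i, i ∉ A → m i ≤ x i) ∧ (∀ i, (y i : ℤ) = x i + c i) ∧
      cutShift A c m (dl x) = dl y) ∨
    (∃ i, i ∉ A ∧ ((x i : ℤ) < m i ∨ (x i : ℤ) + c i < 0)) ∧ cutShift A c m (dl x) = 0 := by
  by_cases h : ∃ i, i ∉ A ∧ ((x i : ℤ) < m i ∨ (x i : ℤ) + c i < 0)
  · exact Or.inr ⟨h, cutShift_dl_not h⟩
  · push Not at h
    let y : Box A := fun i => ⟨x i + c i, mem_side.2 fun hi => (h i hi).2⟩
    exact Or.inl ⟨y, fun i hi => (h i hi).1, fun i => rfl,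
      cutShift_dl (fun i hi => (h i hi).1) fun i => rfl⟩

theorem op_ext_dl {σ τ : Type} {S T : L2 τ →L[ℂ] L2 σ} (h : ∀ x, S (dl x) = T (dl x)) : S = T :=
  op_ext fun x y => by rw [h]

open Classical in
theorem cutShift_apply (A : Finset (Fin n)) (c m : Fin n → ℤ) (x y : Box A) :
    cutShift A c m (dl x) y =
      if (∀ i, (y i : ℤ) = x i + c i) ∧ ∀ i, i ∉ A → m i ≤ x i then 1 else 0 := by
  rcases cutShift_cases A c m x with ⟨z, hm, hz, e⟩ | ⟨⟨i, hi, h⟩, e⟩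
  · rw [e]
    by_cases hy : ∀ i, (y i : ℤ) = x i + c i
    · have : y = z := Box.ext_int fun i => by rw [hy, hz]
      rw [if_pos ⟨hy, hm⟩, this, dl_self]
    · rw [if_neg fun h => hy h.1, dl_ne]
      rintro rfl
      exact hy hz
  · rw [e, if_neg]
    · rfl
    · rintro ⟨h1, h2⟩
      have := h2 i hi
      have := y.nonneg hi
      have := h1 i
      omega

theorem shiftOp_eq_cutShift (A : Finset (Fin n)) (c : Fin n → ℤ) :
    shiftOp A c = cutShift A c 0 := by
  refine op_ext_dl fun x => ?_
  rcases cutShift_cases A c 0 x with ⟨z, -, hz, e⟩ | ⟨⟨i, hi, h⟩, e⟩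
  · rw [e, shiftOp_dl hz]
  · have := x.nonneg hi
    rw [e, shiftOp_dl_not ⟨i, hi, by simpa [this.not_gt] using h⟩]

theorem cutShift_congr {A : Finset (Fin n)} {c m m' : Fin n → ℤ} (h : ∀ i, i ∉ A → m i = m' i) :
    cutShift A c m = cutShift A c m' := by
  classical
  refine op_ext fun x y => ?_
  rw [cutShift_apply, cutShift_apply]
  congr 2
  exact propext (forall₂_congr fun i hi => by rw [h i hi])

theorem cutShift_zero_zero (A : Finset (Fin n)) : cutShift A 0 0 = 1 :=
  op_ext_dl fun x => cutShift_dl (fun _ hi => x.nonneg hi) fun _ => (add_zero _).symm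

theorem cutShift_mul (A : Finset (Fin n)) (c m c' m' : Fin n → ℤ) :
    cutShift A c m * cutShift A c' m' =
      cutShift A (c + c') fun i => max (m' i) (max (-c' i) (m i - c' i)) := by
  refine op_ext_dl fun x => ?_
  rw [mul_apply_eq_comp]
  rcases cutShift_cases A c' m' x with ⟨y, hm, hy, e⟩ | ⟨⟨i, hi, h⟩, e⟩
  · rw [e]
    rcases cutShift_cases A c m y with ⟨z, hm', hz, e'⟩ | ⟨⟨i, hi, h⟩, e'⟩
    · rw [e']
      refine (cutShift_dl (fun i hi => ?_) fun i => ?_).symm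
      · have := hm i hi
        have := hm' i hi
        have := hy i
        have := y.nonneg hi
        omega
      · rw [hz, hy, Pi.add_apply]; ring
    · rw [e', cutShift_dl_not ⟨i, hi, ?_⟩]
      have := hy i
      simp only [Pi.add_apply]
      omega
  · rw [e, map_zero, cutShift_dl_not ⟨i, hi, ?_⟩]
    simp only [Pi.add_apply]
    omega

theorem star_cutShift (A : Finset (Fin n)) (c m : Fin n → ℤ) :
    star (cutShift A c m) = cutShift A (-c) (c + m) := by
  classical
  refine op_ext fun x y => ?_
  rw [ContinuousLinearMap.star_eq_adjoint, adjoint_dl, cutShift_apply, cutShift_apply]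
  simp only [apply_ite conj, map_one, map_zero, Pi.neg_apply, Pi.add_apply]
  congr 1
  refine propext ⟨fun ⟨h1, h2⟩ => ⟨fun i => ?_, fun i hi => ?_⟩,
    fun ⟨h1, h2⟩ => ⟨fun i => ?_, fun i hi => ?_⟩⟩
  · linarith [h1 i]
  · linarith [h1 i, h2 i hi]
  · linarith [h1 i]
  · linarith [h1 i, h2 i hi]

/-! ### The algebra generated by the truncated shifts -/

theorem isClosed_cstarGen {A : Type} [TopologicalSpace A] [Ring A] [StarRing A]
    [IsTopologicalRing A] [ContinuousStar A] [Algebra ℂ A] [StarModule ℂ A] (S : Set A) :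
    IsClosed (cstarGen S : Set A) :=
  StarSubalgebra.isClosed_topologicalClosure _

/-- The linear span of the truncated shifts on `ℓ²(Box A)`, which is a `*`-algebra. -/
noncomputable def cutAlg (A : Finset (Fin n)) : StarSubalgebra ℂ (Op (Box A)) where
  carrier := Submodule.span ℂ (Set.range fun p : (Fin n → ℤ) × (Fin n → ℤ) => cutShift A p.1 p.2)
  add_mem' := Submodule.add_mem _
  mul_mem' {S T} hS hT := by
    have h := Submodule.mul_mem_mul hS hT
    rw [Submodule.span_mul_span] at h
    refine Submodule.span_mono ?_ h
    rintro _ ⟨_, ⟨p, rfl⟩, _, ⟨q, rfl⟩, rfl⟩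
    exact ⟨(_, _), (cutShift_mul A p.1 p.2 q.1 q.2).symm⟩
  algebraMap_mem' c := by
    rw [Algebra.algebraMap_eq_smul_one, ← cutShift_zero_zero A]
    exact Submodule.smul_mem _ c (Submodule.subset_span ⟨(0, 0), rfl⟩)
  star_mem' {T} hT := by
    refine Submodule.span_induction (p := fun T _ => star T ∈ Submodule.span ℂ _) ?_ ?_ ?_ ?_ hT
    · rintro _ ⟨p, rfl⟩
      exact Submodule.subset_span ⟨(_, _), (star_cutShift A p.1 p.2).symm⟩
    · rw [star_zero]; exact Submodule.zero_mem _
    · intro S T _ _ hS hT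
      rw [star_add]; exact Submodule.add_mem _ hS hT
    · intro c T _ hT
      rw [star_smul]; exact Submodule.smul_mem _ _ hT

theorem cutShift_mem_cutAlg (A : Finset (Fin n)) (c m : Fin n → ℤ) : cutShift A c m ∈ cutAlg A :=
  Submodule.subset_span ⟨(c, m), rfl⟩

/-- A closed `*`-algebra containing the compressed translations contains all truncated shifts. -/
theorem cutAlg_closure_le {A : Finset (Fin n)} {B : StarSubalgebra ℂ (Op (Box A))}
    (hB : IsClosed (B : Set (Op (Box A)))) (h : ∀ c, shiftOp A c ∈ B) :
    (cutAlg A).topologicalClosure ≤ B := by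
  refine StarSubalgebra.topologicalClosure_minimal ?_ hB
  intro T hT
  refine Submodule.span_le (p := B.toSubalgebra.toSubmodule).2 ?_ hT
  rintro _ ⟨p, rfl⟩
  exact B.mul_mem (h _) (h _)

/-- Two translations whose supports are disjoint compose without loss. -/
theorem shiftOp_mul {A : Finset (Fin n)} {c c' : Fin n → ℤ} (h : ∀ i, c i = 0 ∨ c' i = 0) :
    shiftOp A c * shiftOp A c' = shiftOp A (c + c') := by
  classical
  rw [shiftOp_eq_cutShift, shiftOp_eq_cutShift, shiftOp_eq_cutShift, cutShift_mul]
  refine op_ext fun x y => ?_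
  rw [cutShift_apply, cutShift_apply]
  refine if_congr (and_congr_right fun h1 => forall₂_congr fun i hi => ?_) rfl rfl
  have := y.nonneg hi
  have := x.nonneg hi
  have := h1 i
  have := h i
  simp only [Pi.add_apply, Pi.zero_apply] at *
  omega

theorem shiftOp_mem_of_single {A : Finset (Fin n)} {B : StarSubalgebra ℂ (Op (Box A))}
    (h : ∀ (i : Fin n) (a : ℤ), shiftOp A (Pi.single i a) ∈ B) (c : Fin n → ℤ) :
    shiftOp A c ∈ B := by
  classical
  have key : ∀ s : Finset (Fin n), shiftOp A (∑ i ∈ s, Pi.single i (c i)) ∈ B := by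
    intro s
    induction s using Finset.induction_on with
    | empty =>
      rw [Finset.sum_empty, shiftOp_eq_cutShift, cutShift_zero_zero]
      exact B.one_mem
    | insert i s hi ih =>
      rw [Finset.sum_insert hi, ← shiftOp_mul]
      · exact B.mul_mem (h _ _) ih
      · intro j
        by_cases hj : j = i
        · subst hj
          right
          rw [Finset.sum_apply]
          exact Finset.sum_eq_zero fun k hk =>
            Pi.single_eq_of_ne (fun e : j = k => hi (by rw [e]; exact hk)) _
        · exact Or.inl (Pi.single_eq_of_ne hj _)
  have := key Finset.univ
  rwa [Finset.univ_sum_single] at this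

/-! ### Multiplication operators and characters -/

section mult
variable {X ι : Type} [TopologicalSpace X] [CompactSpace X] [MeasurableSpace X] [BorelSpace X]
  {μ : MeasureTheory.Measure X} [MeasureTheory.IsFiniteMeasure μ]

/-- `f ↦ M_f` as a continuous linear map. -/
noncomputable def mulOpL (b : HilbertBasis ι ℂ (MeasureTheory.Lp ℂ 2 μ)) : C(X, ℂ) →L[ℂ] Op ι :=
  ((ContinuousLinearMap.compL ℂ _ _ _ (b.repr : MeasureTheory.Lp ℂ 2 μ →L[ℂ] L2 ι)) ∘L
    (ContinuousLinearMap.compL ℂ _ _ _).flip (b.repr.symm : L2 ι →L[ℂ] MeasureTheory.Lp ℂ 2 μ)) ∘L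
    ((ContinuousLinearMap.mul ℂ ℂ).holderL μ ∞ 2 2 ∘L ContinuousMap.toLp ∞ μ ℂ)

/-- A linear and continuous condition on `M_f` holds for all `f` as soon as it holds for `f` in a
family with dense span. -/
theorem mulOp_induction (b : HilbertBasis ι ℂ (MeasureTheory.Lp ℂ 2 μ)) {J : Type}
    {χ : J → C(X, ℂ)} (hχ : (Submodule.span ℂ (Set.range χ)).topologicalClosure = ⊤)
    {κ : Type} (L : Op ι →L[ℂ] Op κ) (B : StarSubalgebra ℂ (Op κ))
    (hB : IsClosed (B : Set (Op κ))) (h : ∀ j, L (mulOp b (χ j)) ∈ B) (f : C(X, ℂ)) :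
    L (mulOp b f) ∈ B := by
  let S : Submodule ℂ C(X, ℂ) := B.toSubalgebra.toSubmodule.comap
    ((L ∘L mulOpL b : C(X, ℂ) →L[ℂ] Op κ) : C(X, ℂ) →ₗ[ℂ] Op κ)
  have hS : IsClosed (S : Set C(X, ℂ)) := hB.preimage (L ∘L mulOpL b).continuous
  have h1 : (Submodule.span ℂ (Set.range χ)).topologicalClosure ≤ S := by
    refine Submodule.topologicalClosure_minimal _ (Submodule.span_le.2 ?_) hS
    rintro _ ⟨j, rfl⟩
    exact h j
  exact h1 (hχ ▸ Submodule.mem_top : f ∈ _)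

/-- If multiplication by `χ` permutes the basis vectors, then so does `M_χ`. -/
theorem mulOp_dl (b : HilbertBasis ι ℂ (MeasureTheory.Lp ℂ 2 μ)) (f : C(X, ℂ)) (x y : ι)
    (h : (fun t => f t * b x t) =ᵐ[μ] b y) : mulOp b f (dl x) = dl y := by
  classical
  have e : ∀ x, b.repr.symm (dl x) = b x := fun x => by
    have h1 : (dl x : L2 ι) = lp.single 2 x (1 : ℂ) := by
      ext j
      simp [dl_apply, Pi.single_apply]
    rw [h1, HilbertBasis.repr_symm_single]
  rw [mulOp_apply, e]
  refine (congrArg b.repr ?_).trans (b.repr.symm_apply_eq.1 (e y)).symm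
  exact MeasureTheory.Lp.ext ((coeFn_mulL2 f _).trans h)

end mult

theorem mulOp_fourier (c x : ℤ) :
    mulOp (fourierBasis (T := (1 : ℝ))) (fourier c) (dl x) = dl (x + c) := by
  refine mulOp_dl _ _ _ _ ?_
  rw [coe_fourierBasis]
  filter_upwards [coeFn_fourierLp (T := (1 : ℝ)) 2 x, coeFn_fourierLp (T := (1 : ℝ)) 2 (x + c)]
    with t h1 h2
  rw [h1, h2, fourier_add, mul_comm]

theorem mulOp_mFourier (c x : Fin n → ℤ) :
    mulOp (μ := MeasureTheory.Measure.pi fun _ => AddCircle.haarAddCircle)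
      (UnitAddTorus.mFourierBasis (d := Fin n)) (UnitAddTorus.mFourier c) (dl x) = dl (x + c) := by
  refine mulOp_dl _ _ _ _ ?_
  rw [UnitAddTorus.coe_mFourierBasis]
  filter_upwards [UnitAddTorus.coeFn_mFourierLp 2 x, UnitAddTorus.coeFn_mFourierLp 2 (x + c)]
    with t h1 h2
  rw [h1, h2, UnitAddTorus.mFourier_add, mul_comm]

/-- The compression of an operator, as a continuous linear map. -/
noncomputable def compressL {ι κ : Type} (j : ι ↪ κ) : Op κ →L[ℂ] Op ι :=
  ContinuousLinearMap.compL ℂ _ _ _ (restr j) ∘L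
    (ContinuousLinearMap.compL ℂ _ _ _).flip (restr j).adjoint

/-! ### Amplification -/

section ampl
variable {K : Fin n → Type} (i : Fin n)

theorem ampl_mul (a b : Op (K i)) : ampl i (a * b) = ampl i a * ampl i b := by
  ext ξ x
  rw [mul_apply_eq_comp, ampl_apply, ampl_apply, mul_apply_eq_comp]
  refine congrArg (fun v : L2 (K i) => a v (x i)) ?_
  ext t
  have h : lineEmb i (lineEmb i x t) = lineEmb i x := by
    ext u
    simp [lineEmb]
  rw [restr_apply, ampl_apply, line_same, h]

theorem ampl_one : ampl i (1 : Op (K i)) = 1 := by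
  ext ξ x
  rw [ampl_apply, one_apply_eq_self, restr_apply, line_self,
    one_apply_eq_self]

/-- Amplification as a continuous linear map. -/
noncomputable def amplL : Op (K i) →L[ℂ] Op (∀ j, K j) :=
  LinearMap.mkContinuous
    { toFun := ampl i
      map_add' := fun a b => rfl
      map_smul' := fun c a => rfl } 1 fun a => by
        rw [one_mul]
        change ‖ampl i a‖ ≤ ‖a‖
        unfold ampl
        exact LinearMap.mkContinuous_norm_le _ (norm_nonneg _) _

/-- Amplification as a `*`-homomorphism. -/
noncomputable def amplHom : Op (K i) →⋆ₐ[ℂ] Op (∀ j, K j) where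
  toFun := ampl i
  map_one' := ampl_one i
  map_zero' := rfl
  map_mul' := ampl_mul i
  map_add' _ _ := rfl
  map_star' a := (star_ampl i a).symm
  commutes' c := by
    rw [Algebra.algebraMap_eq_smul_one, Algebra.algebraMap_eq_smul_one, ← ampl_one i]
    rfl

theorem continuous_amplHom : Continuous (amplHom (K := K) i) := (amplL i).continuous

end ampl

theorem ampl_compress_fourier (A : Finset (Fin n)) (i : Fin n) (a : ℤ) :
    ampl i (compress (Function.Embedding.subtype (· ∈ side A i))
      (mulOp (fourierBasis (T := (1 : ℝ))) (fourier a))) = shiftOp A (Pi.single i a) := by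
  classical
  rw [shiftOp_eq_cutShift]
  refine op_ext fun x y => ?_
  rw [cutShift_apply]
  by_cases h : ∀ j, j ≠ i → y j = x j
  · rw [ampl_dl_apply i _ h, compress_apply, mulOp_fourier, dl_apply]
    congr 1
    refine propext ⟨fun e => ⟨fun j => ?_, fun j hj => Box.nonneg (A := A) x hj⟩, fun e => ?_⟩
    · by_cases hj : j = i
      · subst hj; simpa using e
      · rw [Pi.single_eq_of_ne hj, h j hj, add_zero]
    · simpa using e.1 i
  · rw [ampl_dl_apply_not i _ h, if_neg]
    rintro ⟨e, -⟩
    exact h fun j hj => Subtype.ext (by simpa [Pi.single_eq_of_ne hj] using e j)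

theorem compress_mulOp_mFourier (c : Fin n → ℤ) :
    compress (boxEmb ∅) (mulOp (μ := MeasureTheory.Measure.pi fun _ => AddCircle.haarAddCircle)
      (UnitAddTorus.mFourierBasis (d := Fin n)) (UnitAddTorus.mFourier c)) = shiftOp ∅ c := by
  classical
  rw [shiftOp_eq_cutShift]
  refine op_ext fun x y => ?_
  rw [cutShift_apply, compress_apply, mulOp_mFourier, dl_apply]
  congr 1
  exact propext ⟨fun e => ⟨fun j => congrFun e j, fun j hj => x.nonneg hj⟩, fun e => funext e.1⟩

theorem shiftOp_mem_closure (A : Finset (Fin n)) (c : Fin n → ℤ) :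
    shiftOp A c ∈ (cutAlg A).topologicalClosure := by
  rw [shiftOp_eq_cutShift]
  exact StarSubalgebra.le_topologicalClosure _ (cutShift_mem_cutAlg A _ _)

theorem ampl_toep_mem_closure (A : Finset (Fin n)) (i : Fin n) (f : C(Circle, ℂ)) :
    ampl i (toep (side A i) f) ∈ (cutAlg A).topologicalClosure := by
  have key := mulOp_induction (fourierBasis (T := (1 : ℝ))) span_fourier_closure_eq_top
    (amplL (K := fun j => side A j) i ∘L compressL (Function.Embedding.subtype (· ∈ side A i)))
    (cutAlg A).topologicalClosure (StarSubalgebra.isClosed_topologicalClosure _) (fun c => by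
      have h := shiftOp_mem_closure A (Pi.single i c)
      rw [← ampl_compress_fourier] at h
      exact h)
  exact key (f.comp ⟨AddCircle.toCircle, AddCircle.continuous_toCircle⟩)

theorem ampl_mem_closure (A : Finset (Fin n)) (i : Fin n) {a : Op (side A i)}
    (ha : a ∈ toepAlg (side A i)) : ampl i a ∈ (cutAlg A).topologicalClosure := by
  have hcl : IsClosed (((cutAlg A).topologicalClosure.comap (amplHom (K := fun j => side A j) i) :
      StarSubalgebra ℂ (Op (side A i))) : Set (Op (side A i))) := by
    rw [StarSubalgebra.coe_comap]
    exact (StarSubalgebra.isClosed_topologicalClosure _).preimage (continuous_amplHom _)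
  have hle : toepAlg (side A i) ≤ (cutAlg A).topologicalClosure.comap (amplHom (K := fun j => side A j) i) := by
    refine cstarGen_le ?_ hcl
    rintro _ ⟨f, rfl⟩
    exact ampl_toep_mem_closure A i f
  exact hle ha

theorem continuous_circle_coe : Continuous fun z : Circle => (z : ℂ) := continuous_subtype_val

theorem tAlg_eq_closure (A : Finset (Fin n)) : tAlg A = (cutAlg A).topologicalClosure := by
  have hcl : IsClosed ((cutAlg A).topologicalClosure : Set (Op (Box A))) :=
    StarSubalgebra.isClosed_topologicalClosure _
  apply le_antisymm
  · refine cstarGen_le ?_ hcl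
    rintro _ ⟨⟨i, a⟩, rfl⟩
    exact ampl_mem_closure A i a.2
  · refine cutAlg_closure_le (isClosed_cstarGen _)
      (shiftOp_mem_of_single fun i a => ?_)
    let f : C(Circle, ℂ) := ⟨fun z => ((z ^ a : Circle) : ℂ),
      continuous_circle_coe.comp (continuous_zpow a)⟩
    have hf : (f.comp ⟨AddCircle.toCircle, AddCircle.continuous_toCircle⟩ :
        C(AddCircle (1 : ℝ), ℂ)) = fourier a := by
      ext t
      rw [fourier_apply, AddCircle.toCircle_zsmul]
      rfl
    have h := subset_cstarGen (S := Set.range (tensOp A)) ⟨⟨i, genElem (toep (side A i)) f⟩, rfl⟩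
    have e : tensOp A ⟨i, genElem (toep (side A i)) f⟩ = shiftOp A (Pi.single i a) := by
      rw [← ampl_compress_fourier, ← hf]
      rfl
    rwa [e] at h

theorem orthantToeplitz_eq_closure (n : ℕ) :
    orthantToeplitz n = (cutAlg (∅ : Finset (Fin n))).topologicalClosure := by
  have hcl : IsClosed ((cutAlg (∅ : Finset (Fin n))).topologicalClosure :
      Set (Op (Box (∅ : Finset (Fin n))))) :=
    StarSubalgebra.isClosed_topologicalClosure _
  apply le_antisymm
  · refine cstarGen_le ?_ hcl
    rintro _ ⟨f, rfl⟩
    have key := mulOp_induction (μ := MeasureTheory.Measure.pi fun _ => AddCircle.haarAddCircle)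
      (UnitAddTorus.mFourierBasis (d := Fin n))
      UnitAddTorus.span_mFourier_closure_eq_top (compressL (boxEmb ∅))
      (cutAlg _).topologicalClosure hcl (fun c => by
        have h := shiftOp_mem_closure ∅ c
        rw [← compress_mulOp_mFourier] at h
        exact h)
    exact key _
  · refine cutAlg_closure_le (isClosed_cstarGen _) fun c => ?_
    let f : C(Fin n → Circle, ℂ) := ⟨fun z => ∏ i, ((z i ^ c i : Circle) : ℂ),
      continuous_finsetProd _ fun i _ =>
        continuous_circle_coe.comp ((continuous_zpow (c i)).comp (continuous_apply i))⟩
    have hf : f.comp ⟨fun (x : UnitAddTorus (Fin n)) i => AddCircle.toCircle (x i),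
        continuous_pi fun i => AddCircle.continuous_toCircle.comp (continuous_apply i)⟩ =
          (UnitAddTorus.mFourier c : C(UnitAddTorus (Fin n), ℂ)) := by
      ext t
      change ∏ i, ((AddCircle.toCircle (t i) ^ c i : Circle) : ℂ) = ∏ i, fourier (c i) (t i)
      refine Finset.prod_congr rfl fun i _ => ?_
      rw [fourier_apply, AddCircle.toCircle_zsmul]
    rw [← compress_mulOp_mFourier, ← hf]
    exact subset_cstarGen ⟨f, rfl⟩

/-- The truncated shift as an element of `tAlg A`. -/
noncomputable def cutElem (A : Finset (Fin n)) (c m : Fin n → ℤ) : tAlg A :=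
  ⟨cutShift A c m, by
    rw [tAlg_eq_closure]
    exact StarSubalgebra.le_topologicalClosure _ (cutShift_mem_cutAlg A c m)⟩

/-- The truncated shifts span a dense subspace of `tAlg A`. -/
theorem mem_of_cutElem_mem {A : Finset (Fin n)} (S : Submodule ℂ (tAlg A))
    (hS : IsClosed (S : Set (tAlg A))) (h : ∀ c m, cutElem A c m ∈ S) (T : tAlg A) : T ∈ S := by
  have hcl : IsClosed (Subtype.val '' (S : Set (tAlg A)) : Set (Op (Box A))) :=
    (isClosed_cstarGen _).isClosedEmbedding_subtypeVal.isClosedMap _ hS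
  let S' : Submodule ℂ (Op (Box A)) := S.map (tAlg A).subtype.toAlgHom.toLinearMap
  have hS' : Submodule.span ℂ (Set.range fun p : (Fin n → ℤ) × (Fin n → ℤ) =>
      cutShift A p.1 p.2) ≤ S' := by
    refine Submodule.span_le.2 ?_
    rintro _ ⟨p, rfl⟩
    exact ⟨cutElem A p.1 p.2, h _ _, rfl⟩
  have hT : (T : Op (Box A)) ∈ (cutAlg A).topologicalClosure := (tAlg_eq_closure A).le T.2
  obtain ⟨T', hT', e⟩ := closure_minimal (show (cutAlg A : Set (Op (Box A))) ⊆ _ from hS') hcl hT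
  exact Subtype.ext e ▸ hT'

theorem eq_of_eq_cutElem {A : Finset (Fin n)} {F : Type} [AddCommGroup F] [Module ℂ F]
    [TopologicalSpace F] [T2Space F] {φ ψ : tAlg A →ₗ[ℂ] F} (hφ : Continuous φ) (hψ : Continuous ψ)
    (h : ∀ c m, φ (cutElem A c m) = ψ (cutElem A c m)) (T : tAlg A) : φ T = ψ T :=
  mem_of_cutElem_mem (LinearMap.eqLocus φ ψ) (isClosed_eq hφ hψ) h T

/-! ### The maps `π^D_R` on truncated shifts -/

/-- `π^D_R` as a linear map. -/
noncomputable def projL {D R : Finset (Fin n)} (h : D ⊆ R) : tAlg D →ₗ[ℂ] tAlg R where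
  toFun := proj h
  map_add' := map_add _
  map_smul' := map_smul _

theorem continuous_proj {D R : Finset (Fin n)} (h : D ⊆ R) : Continuous (proj h) := by
  have : IsClosed (tAlg D : Set (Op (Box D))) := isClosed_cstarGen _
  refine continuous_induced_rng.2 ?_
  exact AddMonoidHomClass.continuous_of_bound ((tAlg R).subtype.comp (proj h)) 1 fun x => by
    simpa only [one_mul] using! NonUnitalStarAlgHom.norm_apply_le ((tAlg R).subtype.comp (proj h)) x

theorem continuous_projL {D R : Finset (Fin n)} (h : D ⊆ R) : Continuous (projL h) :=
  continuous_proj h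

theorem proj_asymp {D R : Finset (Fin n)} (h : D ⊆ R) (T : tAlg D) :
    ((T : Op (Box D)), (proj h T : Op (Box R))) ∈ asymp (boxWin D R) :=
  hom_asymp (boxWin_adm h) (tensOp D) (tensOp R) (symbIdx h) (tensOp_asymp h) _ (proj_gen h) T

/-- `π^D_R(T)` is the only operator to which the translates of `T` in the directions `R \ D`
converge. -/
theorem proj_eq_of_asymp {D R : Finset (Fin n)} (h : D ⊆ R) {S : tAlg D} {T : tAlg R}
    (hST : ((S : Op (Box D)), (T : Op (Box R))) ∈ asymp (boxWin D R)) : proj h S = T := by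
  have := norm_le_of_asymp (boxWin_adm h) (sub_mem (proj_asymp h S) hST)
  refine Subtype.ext ?_
  simpa [sub_eq_zero] using this

theorem cutShift_asymp {D R : Finset (Fin n)} (h : D ⊆ R) (c m : Fin n → ℤ) :
    (cutShift D c m, cutShift R c m) ∈ asymp (boxWin D R) := by
  have key : ∀ c m : Fin n → ℤ, ∀ x : Box R, Tendsto (fun k =>
      cutShift D c m (boxWin D R k (dl x)) - boxWin D R k (cutShift R c m (dl x))) atTop
        (𝓝 0) := by
    intro c m x
    refine tendsto_const_nhds.congr' ?_
    -- far out in the directions `R \ D` the cut-off conditions in these directions are void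
    have hlarge : ∀ᶠ k : ℕ in atTop, ∀ i, m i ≤ x i + k := by
      refine eventually_all.2 fun i => ?_
      filter_upwards [eventually_ge_atTop (m i - x i).natAbs] with k hk
      omega
    rcases cutShift_cases R c m x with ⟨z, hm, hz, e⟩ | ⟨⟨i, hi, hlt⟩, e⟩
    · filter_upwards [boxWin_ev h x, boxWin_ev h z, hlarge] with k ⟨y, hy⟩ ⟨z', hz'⟩ hk
      have e1 : boxWin D R k (dl x) = dl y := win_dl _ _ (funext hy)
      have e2 : boxWin D R k (dl z) = dl z' := win_dl _ _ (funext hz')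
      rw [e, e1, e2, cutShift_dl (y := z'), sub_self]
      · intro i hi
        have h1 := hy i
        by_cases hR : i ∈ R
        · have := hk i
          simp only [stepSeq, Finset.mem_sdiff, hR, hi, not_false_eq_true, and_self,
            if_true] at h1
          omega
        · have := hm i hR
          simp only [stepSeq, Finset.mem_sdiff, hR, false_and, if_false] at h1
          omega
      · intro i
        linarith [hy i, hz' i, hz i]
    · filter_upwards [boxWin_ev h x] with k ⟨y, hy⟩
      have e1 : boxWin D R k (dl x) = dl y := win_dl _ _ (funext hy)
      have h1 := hy i
      simp only [stepSeq, Finset.mem_sdiff, hi, false_and, if_false, sub_zero] at h1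
      rw [e, e1, map_zero, cutShift_dl_not ⟨i, fun hD => hi (h hD), by rwa [h1]⟩, sub_zero]
  refine asymp_of_dl (boxWin_adm h).1 (key c m) ?_
  rw [star_cutShift, star_cutShift]
  exact key _ _

theorem proj_cutElem {D R : Finset (Fin n)} (h : D ⊆ R) (c m : Fin n → ℤ) :
    proj h (cutElem D c m) = cutElem R c m :=
  proj_eq_of_asymp h (cutShift_asymp h c m)

/-! ### The compressions `ρ_A` -/

theorem compress_cutShift (A : Finset (Fin n)) (c m : Fin n → ℤ) :
    compress (orthantEmb A) (cutShift A c m) =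
      cutShift ∅ c fun i => if i ∈ A then 0 else m i := by
  classical
  refine op_ext fun x y => ?_
  rw [compress_apply, cutShift_apply, cutShift_apply]
  refine if_congr (and_congr_right fun _ => forall_congr' fun i => ?_) rfl rfl
  have hx := x.nonneg (Finset.notMem_empty i)
  by_cases hi : i ∈ A
  · simpa [hi] using hx
  · simp only [hi, not_false_eq_true, true_imp_iff, Finset.notMem_empty, if_false]
    rfl

theorem compress_mem (A : Finset (Fin n)) (T : tAlg A) :
    compress (orthantEmb A) (T : Op (Box A)) ∈ tAlg (∅ : Finset (Fin n)) := by
  let S : Submodule ℂ (tAlg A) := (tAlg (∅ : Finset (Fin n))).toSubalgebra.toSubmodule.comap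
    (compress (orthantEmb A) ∘ₗ (tAlg A).subtype.toAlgHom.toLinearMap)
  have hS : IsClosed (S : Set (tAlg A)) :=
    (isClosed_cstarGen _).preimage ((compressL (orthantEmb A)).continuous.comp
      continuous_subtype_val)
  refine mem_of_cutElem_mem S hS (fun c m => ?_) T
  change compress (orthantEmb A) (cutShift A c m) ∈ tAlg (∅ : Finset (Fin n))
  rw [compress_cutShift]
  exact (cutElem ∅ c _).2

/-- The linear map `ρ_A`, the compression to `ℓ²((ℤ_{≥ 0})ⁿ)`. -/
noncomputable def rho (A : Finset (Fin n)) : tAlg A →ₗ[ℂ] tAlg (∅ : Finset (Fin n)) where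
  toFun T := ⟨compress (orthantEmb A) T, compress_mem A T⟩
  map_add' S T := Subtype.ext (map_add (compress (orthantEmb A)) (S : Op (Box A)) T)
  map_smul' c T := Subtype.ext (map_smul (compress (orthantEmb A)) c (T : Op (Box A)))

theorem continuous_rho (A : Finset (Fin n)) : Continuous (rho A) :=
  continuous_induced_rng.2 ((compressL (orthantEmb A)).continuous.comp continuous_subtype_val)

theorem rho_cutElem (A : Finset (Fin n)) (c m : Fin n → ℤ) :
    rho A (cutElem A c m) = cutElem ∅ c fun i => if i ∈ A then 0 else m i :=
  Subtype.ext (compress_cutShift A c m)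

theorem cutElem_congr {A : Finset (Fin n)} {c m m' : Fin n → ℤ} (h : ∀ i, i ∉ A → m i = m' i) :
    cutElem A c m = cutElem A c m' :=
  Subtype.ext (cutShift_congr h)

/-- `ρ_A` is a section of `π_A`. -/
theorem proj_rho (A : Finset (Fin n)) (T : tAlg A) : proj (Finset.empty_subset A) (rho A T) = T :=
  eq_of_eq_cutElem (φ := projL (Finset.empty_subset A) ∘ₗ rho A) (ψ := LinearMap.id)
    ((continuous_projL _).comp (continuous_rho A)) continuous_id (fun c m => by
      change proj (Finset.empty_subset A) (rho A (cutElem A c m)) = cutElem A c m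
      rw [rho_cutElem, proj_cutElem]
      exact cutElem_congr fun i hi => if_neg hi) T

theorem rho_empty (T : tAlg (∅ : Finset (Fin n))) : rho ∅ T = T :=
  Subtype.ext (op_ext fun x y => compress_apply (orthantEmb ∅) (T : Op (Box ∅)) x y)

theorem proj_self {A : Finset (Fin n)} (h : A ⊆ A) (T : tAlg A) : proj h T = T := by
  have := proj_proj (Finset.empty_subset A) h (rho A T)
  rwa [proj_rho] at this

/-- After applying `π_j`, it makes no difference whether the cut-off in direction `j` was removed
before compressing. -/
theorem proj_rho_insert (A : Finset (Fin n)) (j : Fin n) (T : tAlg A) :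
    proj (Finset.empty_subset {j}) (rho A T) =
      proj (Finset.empty_subset {j}) (rho (insert j A) (proj (Finset.subset_insert j A) T)) :=
  eq_of_eq_cutElem (φ := projL (Finset.empty_subset {j}) ∘ₗ rho A)
    (ψ := projL (Finset.empty_subset {j}) ∘ₗ rho (insert j A) ∘ₗ projL (Finset.subset_insert j A))
    ((continuous_projL _).comp (continuous_rho A))
    ((continuous_projL _).comp ((continuous_rho _).comp (continuous_projL _))) (fun c m => by
      change proj (Finset.empty_subset {j}) (rho A (cutElem A c m)) =
        proj (Finset.empty_subset {j})
          (rho (insert j A) (proj (Finset.subset_insert j A) (cutElem A c m)))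
      rw [proj_cutElem, rho_cutElem, rho_cutElem, proj_cutElem, proj_cutElem]
      refine cutElem_congr fun i hi => ?_
      have hij : i ≠ j := fun e => hi (Finset.mem_singleton.2 e)
      simp [hij]) T

/-! ### Compatible tuples -/

theorem isClosed_sAlg (n : ℕ) : IsClosed (sAlg n : Set (∀ i : Fin n, tAlg {i})) := by
  have : (sAlg n : Set (∀ i : Fin n, tAlg {i})) = ⋂ (i) (j) (_ : i < j),
      {T | proj (show ({i} : Finset (Fin n)) ⊆ {i, j} by simp) (T i) =
        proj (show ({j} : Finset (Fin n)) ⊆ {i, j} by simp) (T j)} := by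
    ext T
    simp only [Set.mem_iInter]
    rfl
  rw [this]
  exact isClosed_iInter fun i => isClosed_iInter fun j => isClosed_iInter fun _ =>
    isClosed_eq ((continuous_proj _).comp (continuous_apply i))
      ((continuous_proj _).comp (continuous_apply j))

theorem proj_eq_proj_of_lt (T : sAlg n) {A : Finset (Fin n)} {i j : Fin n} (hij : i < j)
    (hi : i ∈ A) (hj : j ∈ A) :
    proj (Finset.singleton_subset_iff.2 hi) (T.1 i) =
      proj (Finset.singleton_subset_iff.2 hj) (T.1 j) := by
  have h : ({i, j} : Finset (Fin n)) ⊆ A :=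
    Finset.insert_subset hi (Finset.singleton_subset_iff.2 hj)
  have := congrArg (proj h) (T.2 i j hij)
  rwa [proj_proj, proj_proj] at this

/-- The element `T_A = π^i_A(T_i)` does not depend on `i ∈ A`. -/
theorem proj_eq_face (T : sAlg n) {A : Finset (Fin n)} (hA : A.Nonempty) {i : Fin n} (hi : i ∈ A) :
    proj (Finset.singleton_subset_iff.2 hi) (T.1 i) = face hA T := by
  rcases (A.min'_le i hi).lt_or_eq with h | h
  · exact (proj_eq_proj_of_lt T h (A.min'_mem hA) hi).symm
  · have key : ∀ j (hj : j ∈ A), j = i →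
        proj (Finset.singleton_subset_iff.2 hi) (T.1 i) =
          proj (Finset.singleton_subset_iff.2 hj) (T.1 j) := by
      rintro _ _ rfl
      rfl
    exact key _ (A.min'_mem hA) h

theorem proj_face (T : sAlg n) {A B : Finset (Fin n)} (hA : A.Nonempty) (hB : B.Nonempty)
    (h : A ⊆ B) : proj h (face hA T) = face hB T := by
  obtain ⟨i, hi⟩ := id hA
  rw [← proj_eq_face T hA hi, ← proj_eq_face T hB (h hi), proj_proj]

theorem face_add {A : Finset (Fin n)} (hA : A.Nonempty) (S T : sAlg n) :
    face hA (S + T) = face hA S + face hA T :=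
  map_add (projL (Finset.singleton_subset_iff.2 (A.min'_mem hA))) (S.1 (A.min' hA)) (T.1 _)

theorem face_smul {A : Finset (Fin n)} (hA : A.Nonempty) (c : ℂ) (T : sAlg n) :
    face hA (c • T) = c • face hA T :=
  map_smul (projL (Finset.singleton_subset_iff.2 (A.min'_mem hA))) c (T.1 (A.min' hA))

/-! ### The alternating sum -/

theorem sum_neg_one_pow_card_smul {α M : Type} [Fintype α] [DecidableEq α] [AddCommGroup M]
    [Module ℂ M] (g : Finset α → M) (i : α) (h : ∀ A, i ∉ A → g (insert i A) = g A) :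
    ∑ A, (-1 : ℂ) ^ A.card • g A = 0 := by
  rw [← Finset.powerset_univ, ← Finset.insert_erase (Finset.mem_univ i),
    Finset.sum_powerset_insert (Finset.notMem_erase i _), ← Finset.sum_add_distrib]
  refine Finset.sum_eq_zero fun A hA => ?_
  have hi : i ∉ A := fun hi => Finset.notMem_erase i _ (Finset.mem_powerset.1 hA hi)
  rw [h A hi, Finset.card_insert_of_notMem hi, pow_succ, mul_neg_one, neg_smul, add_neg_cancel]

theorem sum_Icc_card_nonempty {M : Type} [AddCommMonoid M]
    (F : ∀ A : Finset (Fin n), A.Nonempty → M) :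
    ∑ k ∈ Finset.Icc 1 n, ∑ A : {A : Finset (Fin n) // A.card = k ∧ A.Nonempty}, F A.1 A.2.2 =
      ∑ A : Finset (Fin n), if h : A.Nonempty then F A h else 0 := by
  classical
  have h1 : ∀ k, ∑ A : {A : Finset (Fin n) // A.card = k ∧ A.Nonempty}, F A.1 A.2.2 =
      ∑ A : Finset (Fin n), if k = A.card then (if h : A.Nonempty then F A h else 0) else 0 := by
    intro k
    rw [← Finset.sum_filter, ← Finset.sum_filter_of_ne (p := Finset.Nonempty),
      Finset.filter_filter]
    · rw [Finset.sum_subtype (p := fun A : Finset (Fin n) => A.card = k ∧ A.Nonempty) _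
        (fun A => by simp [eq_comm])]
      exact Finset.sum_congr rfl fun A _ => (dif_pos A.2.2).symm
    · intro A _ hA
      by_contra h
      exact hA (dif_neg h)
  simp_rw [h1]
  rw [Finset.sum_comm]
  refine Finset.sum_congr rfl fun A _ => ?_
  rw [Finset.sum_ite_eq']
  split_ifs with h2 h3 h3
  · rfl
  · rfl
  · refine absurd (Finset.mem_Icc.2 ⟨h3.card_pos, ?_⟩) h2
    simpa using A.card_le_univ
  · rfl

theorem sum_Icc_neg_one_pow_smul {M : Type} [AddCommGroup M] [Module ℂ M]
    (g : Finset (Fin n) → M) (i : Fin n) (h : ∀ A, i ∉ A → g (insert i A) = g A) :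
    ∑ k ∈ Finset.Icc 1 n, ∑ A : {A : Finset (Fin n) // A.card = k ∧ A.Nonempty},
      (-1 : ℂ) ^ (k + 1) • g A.1 = g ∅ := by
  have h1 := sum_Icc_card_nonempty (n := n) fun A _ => (-1 : ℂ) ^ (A.card + 1) • g A
  have h2 : ∀ k, ∀ A : {A : Finset (Fin n) // A.card = k ∧ A.Nonempty},
      (-1 : ℂ) ^ (k + 1) • g A.1 = (-1 : ℂ) ^ (A.1.card + 1) • g A.1 := fun k A => by rw [A.2.1]
  simp_rw [h2]
  rw [h1, ← Finset.add_sum_erase _ _ (Finset.mem_univ ∅), dif_neg Finset.not_nonempty_empty,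
    zero_add]
  have hsum := sum_neg_one_pow_card_smul g i h
  rw [← Finset.add_sum_erase _ _ (Finset.mem_univ ∅), Finset.card_empty, pow_zero, one_smul,
    add_eq_zero_iff_eq_neg, ← Finset.sum_neg_distrib] at hsum
  rw [hsum]
  refine Finset.sum_congr rfl fun A hA => ?_
  rw [dif_pos (Finset.nonempty_iff_ne_empty.2 (Finset.ne_of_mem_erase hA)), pow_succ, mul_neg_one,
    neg_smul]

/-- The splitting `ρ'` of `γ_n`. -/
noncomputable def splitting (T : sAlg n) : tAlg (∅ : Finset (Fin n)) :=
  ∑ k ∈ Finset.Icc 1 n, ∑ A : {A : Finset (Fin n) // A.card = k ∧ A.Nonempty},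
    (-1 : ℂ) ^ (k + 1) • rho A.1 (face A.2.2 T)

theorem splitting_add (S T : sAlg n) : splitting (S + T) = splitting S + splitting T := by
  unfold splitting
  rw [← Finset.sum_add_distrib]
  refine Finset.sum_congr rfl fun k _ => ?_
  rw [← Finset.sum_add_distrib]
  refine Finset.sum_congr rfl fun A _ => ?_
  rw [face_add, map_add, smul_add]

theorem splitting_smul (c : ℂ) (T : sAlg n) : splitting (c • T) = c • splitting T := by
  unfold splitting
  rw [Finset.smul_sum]
  refine Finset.sum_congr rfl fun k _ => ?_
  rw [Finset.smul_sum]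
  refine Finset.sum_congr rfl fun A _ => ?_
  rw [face_smul, map_smul, smul_comm]

/-- The terms of the alternating sum, seen through `π_j`, cancel in pairs `A`, `A ∪ {j}`; the only
term without a partner is the one for `A = {j}`. -/
theorem projL_splitting (T : sAlg n) (j : Fin n) :
    projL (Finset.empty_subset {j}) (splitting T) = T.1 j := by
  have hface : ∀ (A B : Finset (Fin n)) (hA : A.Nonempty) (hB : B.Nonempty), A = B →
      rho A (face hA T) = rho B (face hB T) := by
    rintro A _ _ _ rfl
    rfl
  obtain ⟨g, hg⟩ : ∃ g : Finset (Fin n) → tAlg {j}, ∀ A,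
      projL (Finset.empty_subset {j}) (rho (insert j A) (face (Finset.insert_nonempty j A) T)) =
        g A := ⟨_, fun _ => rfl⟩
  have hg' : ∀ A (hA : A.Nonempty),
      projL (Finset.empty_subset {j}) (rho A (face hA T)) = g A := by
    intro A hA
    have := proj_rho_insert A j (face hA T)
    rw [proj_face T hA (Finset.insert_nonempty j A)] at this
    exact this.trans (hg A)
  have h0 : g ∅ = T.1 j := by
    rw [← hg, hface _ {j} _ (Finset.singleton_nonempty j) (insert_empty_eq j)]
    refine (proj_rho {j} _).trans ?_
    rw [← proj_eq_face T (Finset.singleton_nonempty j) (Finset.mem_singleton_self j), proj_self]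
  have hins : ∀ A, j ∉ A → g (insert j A) = g A := fun A _ => by
    rw [← hg, ← hg, hface _ _ _ (Finset.insert_nonempty j A) (Finset.insert_idem j A)]
  rw [← h0, ← sum_Icc_neg_one_pow_smul g j hins, splitting, map_sum]
  refine Finset.sum_congr rfl fun k _ => ?_
  rw [map_sum]
  refine Finset.sum_congr rfl fun A _ => ?_
  rw [map_smul, hg']

theorem gammaN_splitting (T : sAlg n) : gammaN n (splitting T) = T :=
  Subtype.ext (funext fun j => projL_splitting T j)

/-! ### Compact operators -/

section compact
variable {ι : Type}

/-- The operator `ξ ↦ ⟨v, ξ⟩ δ_y`. -/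
noncomputable def rankOne (y : ι) (v : L2 ι) : Op ι := (innerSL ℂ v).smulRight (dl y)

theorem rankOne_apply (y : ι) (v ξ : L2 ι) : rankOne y v ξ = inner ℂ v ξ • dl y := rfl

theorem rankOne_dl_dl (x y : ι) : rankOne y (dl x) (dl x) = dl y := by
  rw [rankOne_apply, inner_dl, dl_self, one_smul]

theorem rankOne_dl_ne {x z : ι} (y : ι) (h : z ≠ x) : rankOne y (dl x) (dl z) = 0 := by
  rw [rankOne_apply, inner_dl, dl_ne h.symm, zero_smul]

theorem isCompactOperator_rankOne (y : ι) (v : L2 ι) : IsCompactOperator (rankOne y v) := by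
  have h : IsCompactOperator ((ContinuousLinearMap.id ℂ ℂ).smulRight (dl y) : ℂ →L[ℂ] L2 ι) :=
    isCompactOperator_of_locallyCompactSpace_rng _
  exact h.comp_clm (innerSL ℂ v)

theorem isClosed_isCompactOperator : IsClosed {T : Op ι | IsCompactOperator T} :=
  isClosed_setOfPred_isCompactOperator

theorem dl_sum (s : Finset ι) (ξ : L2 ι) (i : ι) :
    (∑ y ∈ s, ξ y • dl y) i = open Classical in if i ∈ s then ξ i else 0 := by
  classical
  have : (∑ y ∈ s, ξ y • dl y) i = ∑ y ∈ s, ξ y * dl y i := by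
    rw [lp.coeFn_sum, Finset.sum_apply]
    rfl
  rw [this]
  simp [dl_apply]

/-- The coordinate truncations of a vector of `ℓ²` converge to it. -/
theorem exists_norm_sub_sum_lt (ξ : L2 ι) {ε : ℝ} (hε : 0 < ε) :
    ∃ s : Finset ι, ∀ t, s ⊆ t → ‖ξ - ∑ y ∈ t, ξ y • dl y‖ < ε := by
  classical
  have h := lp.hasSum_single (p := 2) (by norm_num) ξ
  obtain ⟨s, hs⟩ := Filter.eventually_atTop.1 ((Metric.tendsto_nhds.1 h) ε hε)
  refine ⟨s, fun t ht => ?_⟩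
  have := hs t ht
  rw [dist_eq_norm, norm_sub_rev] at this
  have e : ∀ y, lp.single (E := fun _ : ι => ℂ) 2 y (ξ y) = ξ y • dl y := by
    intro y
    ext j
    by_cases hj : j = y
    · subst hj; simp [dl_apply]
    · simp [dl_apply, hj]
  simpa only [e] using this

theorem norm_sub_sum_le (s : Finset ι) (ξ : L2 ι) : ‖ξ - ∑ y ∈ s, ξ y • dl y‖ ≤ ‖ξ‖ := by
  classical
  rw [← sq_le_sq₀ (norm_nonneg _) (norm_nonneg _), ← tsum_sq, ← tsum_sq]
  refine (summable_sq _).tsum_le_tsum (fun i => ?_) (summable_sq _)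
  rw [lp.coeFn_sub, Pi.sub_apply, dl_sum]
  split_ifs
  · simp
  · simp

/-- Every compact operator on `ℓ²(ι)` is a norm limit of linear combinations of matrix units. -/
theorem mem_of_rankOne_mem {S : Submodule ℂ (Op ι)} (hS : IsClosed (S : Set (Op ι)))
    (h : ∀ x y, rankOne y (dl x) ∈ S) {K : Op ι} (hK : IsCompactOperator K) : K ∈ S := by
  classical
  have h1 : ∀ y v, rankOne y v ∈ S := by
    intro y v
    let L : L2 ι →L⋆[ℂ] Op ι :=
      ((ContinuousLinearMap.smulRightL ℂ (L2 ι) (L2 ι)).flip (dl y)) ∘SL (innerSL ℂ)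
    have hL : IsClosed ((S.comap (L : L2 ι →ₛₗ[starRingEnd ℂ] Op ι) : Submodule ℂ (L2 ι)) :
      Set (L2 ι)) := hS.preimage L.continuous
    exact dl_induction _ hL (fun x => h x y) v
  have h2 : ∀ s : Finset ι, ∑ y ∈ s, rankOne y (K.adjoint (dl y)) ∈ S := fun s =>
    S.sum_mem fun y _ => h1 y _
  have h3 : ∀ (s : Finset ι) ξ, (∑ y ∈ s, rankOne y (K.adjoint (dl y))) ξ =
      ∑ y ∈ s, K ξ y • dl y := by
    intro s ξ
    rw [_root_.sum_apply]
    refine Finset.sum_congr rfl fun y _ => ?_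
    rw [rankOne_apply, ContinuousLinearMap.adjoint_inner_left, inner_dl]
  refine hS.closure_subset_iff.2 (le_refl (S : Set (Op ι)))
    (Metric.mem_closure_iff.2 fun ε hε => ?_)
  have htb := (hK.isCompact_closure_image_closedBall
    (f := (K : L2 ι →ₗ[ℂ] L2 ι)) 1).totallyBounded.subset subset_closure
  obtain ⟨t, htf, ht⟩ := Metric.totallyBounded_iff.1 htb (ε / 4) (by positivity)
  choose! f hf using fun v : L2 ι => exists_norm_sub_sum_lt v (show 0 < ε / 4 by positivity)
  refine ⟨_, h2 (htf.toFinset.biUnion f), ?_⟩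
  rw [dist_eq_norm]
  refine lt_of_le_of_lt (ContinuousLinearMap.opNorm_le_of_unit_norm (C := ε / 2) (by positivity)
    fun ξ hξ => ?_) (by linarith)
  rw [_root_.sub_apply, h3]
  obtain ⟨v, hv, hξv⟩ := Set.mem_iUnion₂.1 (ht ⟨ξ, by simp [hξ], rfl⟩)
  have a : ‖K ξ - v‖ < ε / 4 := mem_ball_iff_norm.1 hξv
  set s := htf.toFinset.biUnion f
  have b := hf v s (Finset.subset_biUnion_of_mem f (htf.mem_toFinset.2 hv))
  have c := norm_sub_sum_le s (K ξ - v)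
  have e : K ξ - ∑ y ∈ s, K ξ y • dl y =
      (K ξ - v - ∑ y ∈ s, (K ξ - v) y • dl y) + (v - ∑ y ∈ s, v y • dl y) := by
    have : ∑ y ∈ s, (K ξ - v) y • (dl y : L2 ι) =
        ∑ y ∈ s, K ξ y • dl y - ∑ y ∈ s, v y • dl y := by
      rw [← Finset.sum_sub_distrib]
      exact Finset.sum_congr rfl fun y _ => sub_smul _ _ _
    rw [this]
    abel
  rw [e]
  exact (norm_add_le _ _).trans (by linarith)

/-- An operator that kills all but finitely many basis vectors is compact. -/
theorem isCompactOperator_of_finite {T : Op ι} {s : Set ι} (hs : s.Finite)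
    (h : ∀ x, x ∉ s → T (dl x) = 0) : IsCompactOperator T := by
  classical
  have : T = ∑ x ∈ hs.toFinset, T * rankOne x (dl x) := by
    refine op_ext_dl fun z => ?_
    rw [_root_.sum_apply]
    by_cases hz : z ∈ s
    · rw [Finset.sum_eq_single z]
      · rw [mul_apply_eq_comp, rankOne_dl_dl]
      · intro x _ hx
        rw [mul_apply_eq_comp, rankOne_dl_ne _ hx.symm, map_zero]
      · intro h'
        exact absurd (hs.mem_toFinset.2 hz) h'
    · rw [h z hz, Finset.sum_eq_zero]
      intro x hx
      rw [mul_apply_eq_comp, rankOne_dl_ne, map_zero]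
      rintro rfl
      exact hz (hs.mem_toFinset.1 hx)
  rw [this]
  exact Submodule.sum_mem (compactOperator (RingHom.id ℂ) (L2 ι) (L2 ι))
    fun x _ => (isCompactOperator_rankOne x (dl x)).clm_comp T

end compact

/-! ### Compact operators in the Toeplitz algebra -/

/-- The alternating sum `∑_A (-1)^|A| ρ_A π_A` on the truncated shift with data `c`, `m`, that is,
up to sign the truncated shift restricted to the `x` with `x i < m i` for all `i`. -/
noncomputable def cornerShift (c m : Fin n → ℤ) : Op (Box (∅ : Finset (Fin n))) :=
  ∑ A : Finset (Fin n), (-1 : ℂ) ^ A.card • cutShift ∅ c fun i => if i ∈ A then 0 else m i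

theorem cutShift_dl_congr {A : Finset (Fin n)} {c m m' : Fin n → ℤ} {x : Box A}
    (h : ∀ i, i ∉ A → (m i ≤ x i ↔ m' i ≤ x i)) :
    cutShift A c m (dl x) = cutShift A c m' (dl x) := by
  classical
  ext y
  rw [cutShift_apply, cutShift_apply]
  exact if_congr (and_congr_right fun _ => forall₂_congr h) rfl rfl

theorem cornerShift_dl (c m : Fin n → ℤ) (x : Box (∅ : Finset (Fin n))) :
    cornerShift c m (dl x) = ∑ A : Finset (Fin n),
      (-1 : ℂ) ^ A.card • cutShift ∅ c (fun i => if i ∈ A then 0 else m i) (dl x) := by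
  rw [cornerShift, _root_.sum_apply]
  rfl

theorem cornerShift_dl_of_le {c m : Fin n → ℤ} {x : Box (∅ : Finset (Fin n))} {i : Fin n}
    (h : m i ≤ x i) : cornerShift c m (dl x) = 0 := by
  rw [cornerShift_dl]
  refine sum_neg_one_pow_card_smul
    (fun A => cutShift ∅ c (fun i => if i ∈ A then 0 else m i) (dl x)) i fun A hA => ?_
  refine cutShift_dl_congr fun j _ => ?_
  by_cases hj : j = i
  · subst hj
    simpa [hA, h] using x.nonneg (Finset.notMem_empty j)
  · simp [hj]

theorem isCompactOperator_cornerShift (c m : Fin n → ℤ) : IsCompactOperator (cornerShift c m) := by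
  have hs : (boxEmb (∅ : Finset (Fin n)) ⁻¹' Set.Icc 0 m).Finite :=
    (Set.finite_Icc 0 m).preimage (boxEmb ∅).injective.injOn
  refine isCompactOperator_of_finite hs fun x hx => ?_
  by_contra h
  refine hx ⟨fun i => x.nonneg (Finset.notMem_empty i), fun i => ?_⟩
  by_contra hi
  exact h (cornerShift_dl_of_le (not_le.1 hi).le)

/-- The origin of the orthant. -/
def boxZero (A : Finset (Fin n)) : Box A := fun _ => ⟨0, mem_side.2 fun _ => le_rfl⟩

/-- The projection onto the origin of the orthant lies in the Toeplitz algebra. -/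
theorem cornerShift_zero_one :
    (-1 : ℂ) ^ n • cornerShift (0 : Fin n → ℤ) 1 = rankOne (boxZero ∅) (dl (boxZero ∅)) := by
  refine op_ext_dl fun x => ?_
  change (-1 : ℂ) ^ n • cornerShift 0 1 (dl x) = _
  by_cases hx : x = boxZero ∅
  · subst hx
    -- only `A = univ` contributes at the origin, as the cut-off elsewhere excludes it
    rw [rankOne_dl_dl, cornerShift_dl, Finset.sum_eq_single Finset.univ,
      cutShift_dl (y := boxZero ∅), smul_smul,
      Finset.card_univ, Fintype.card_fin, ← mul_pow]
    · simp
    · intro i _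
      simp [boxZero]
    · intro i
      simp
    · intro A _ hA
      obtain ⟨i, hi⟩ : ∃ i, i ∉ A := by
        by_contra h
        push Not at h
        exact hA (Finset.eq_univ_of_forall h)
      rw [cutShift_dl_not ⟨i, Finset.notMem_empty i, Or.inl ?_⟩, smul_zero]
      simp [hi, boxZero]
    · exact fun h => absurd (Finset.mem_univ _) h
  · obtain ⟨i, hi⟩ : ∃ i, (x i : ℤ) ≠ 0 := by
      by_contra h
      push Not at h
      exact hx (Box.ext_int h)
    have := x.nonneg (Finset.notMem_empty i)
    rw [rankOne_dl_ne _ hx, cornerShift_dl_of_le (i := i), smul_zero]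
    simp only [Pi.one_apply]
    omega

theorem cutShift_mem_tAlg (A : Finset (Fin n)) (c m : Fin n → ℤ) : cutShift A c m ∈ tAlg A :=
  (cutElem A c m).2

theorem rankOne_mem_tAlg (x y : Box (∅ : Finset (Fin n))) :
    rankOne y (dl x) ∈ tAlg (∅ : Finset (Fin n)) := by
  have h0 : rankOne (boxZero ∅) (dl (boxZero ∅)) ∈ tAlg (∅ : Finset (Fin n)) := by
    rw [← cornerShift_zero_one]
    exact SMulMemClass.smul_mem _ (sum_mem fun A _ =>
      SMulMemClass.smul_mem _ (cutShift_mem_tAlg _ _ _))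
  -- translate `x` to the origin, project there, and translate the origin to `y`
  have e : rankOne y (dl x) = cutShift ∅ (fun i => (y i : ℤ)) 0 *
      (rankOne (boxZero ∅) (dl (boxZero ∅)) *
        cutShift ∅ (fun i => -(x i : ℤ)) fun i => (x i : ℤ)) := by
    refine op_ext_dl fun z => ?_
    rw [mul_apply_eq_comp, mul_apply_eq_comp]
    by_cases hz : z = x
    · subst hz
      rw [rankOne_dl_dl, cutShift_dl (y := boxZero ∅), rankOne_dl_dl, cutShift_dl (y := y)]
      · intro i _
        simp [boxZero]
      · intro i
        simp [boxZero]
      · exact fun i _ => le_rfl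
      · intro i
        simp [boxZero]
    · rw [rankOne_dl_ne _ hz]
      rcases cutShift_cases ∅ (fun i => -(x i : ℤ)) (fun i => (x i : ℤ)) z with
        ⟨w, -, hw, h⟩ | ⟨-, h⟩
      · rw [h, rankOne_dl_ne, map_zero]
        rintro rfl
        refine hz (Box.ext_int fun i => ?_)
        have : (0 : ℤ) = z i + -(x i : ℤ) := hw i
        linarith
      · rw [h, map_zero, map_zero]
  rw [e]
  exact mul_mem (cutShift_mem_tAlg _ _ _) (mul_mem h0 (cutShift_mem_tAlg _ _ _))

theorem compact_mem_tAlg {K : Op (Box (∅ : Finset (Fin n)))} (hK : IsCompactOperator K) :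
    K ∈ tAlg (∅ : Finset (Fin n)) :=
  mem_of_rankOne_mem (S := (tAlg (∅ : Finset (Fin n))).toSubalgebra.toSubmodule)
    (isClosed_cstarGen _) rankOne_mem_tAlg hK

/-- The inclusion `ι_n` of the compact operators in the Toeplitz algebra. -/
noncomputable def compactInclusion (n : ℕ) :
    compactOps (L2 (Box (∅ : Finset (Fin n)))) →⋆ₙₐ[ℂ] tAlg (∅ : Finset (Fin n)) where
  toFun K := ⟨K, compact_mem_tAlg K.2⟩
  map_smul' _ _ := rfl
  map_zero' := rfl
  map_add' _ _ := rfl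
  map_mul' _ _ := rfl
  map_star' _ := rfl

theorem star_rankOne_dl {ι : Type} (x y : ι) : star (rankOne y (dl x)) = rankOne x (dl y) := by
  refine op_ext fun z w => ?_
  rw [ContinuousLinearMap.star_eq_adjoint, adjoint_dl, rankOne_apply, rankOne_apply, inner_dl,
    inner_dl, lp.coeFn_smul, lp.coeFn_smul, Pi.smul_apply, Pi.smul_apply, smul_eq_mul, smul_eq_mul,
    dl_apply, dl_apply, dl_apply, dl_apply]
  split_ifs <;> simp_all

/-- Compact operators vanish at infinity: moving them off to infinity in direction `i`, they
converge strongly to `0`. -/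
theorem compact_asymp {K : Op (Box (∅ : Finset (Fin n)))} (hK : IsCompactOperator K) (i : Fin n) :
    (K, (0 : Op (Box {i}))) ∈ asymp (boxWin ∅ {i}) := by
  have hW := boxWin_adm (Finset.empty_subset ({i} : Finset (Fin n)))
  let S : Submodule ℂ (Op (Box (∅ : Finset (Fin n)))) :=
    (asymp (boxWin ∅ {i})).toSubalgebra.toSubmodule.comap
      (LinearMap.inl ℂ (Op (Box (∅ : Finset (Fin n)))) (Op (Box {i})))
  have hS : IsClosed (S : Set (Op (Box (∅ : Finset (Fin n))))) :=
    (isClosed_asymp _ hW.1).preimage (continuous_id.prodMk continuous_const)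
  refine mem_of_rankOne_mem (S := S) hS (fun x y => ?_) hK
  have key : ∀ (x y : Box (∅ : Finset (Fin n))) (z : Box {i}), Tendsto (fun k =>
      rankOne y (dl x) (boxWin ∅ {i} k (dl z)) - boxWin ∅ {i} k ((0 : Op (Box {i})) (dl z)))
        atTop (𝓝 0) := by
    intro x y z
    refine tendsto_const_nhds.congr' ?_
    filter_upwards [boxWin_ev (Finset.empty_subset ({i} : Finset (Fin n))) z,
      eventually_gt_atTop (x i - z i : ℤ).natAbs] with k ⟨w, hw⟩ hk
    have e1 : boxWin ∅ {i} k (dl z) = dl w := win_dl _ _ (funext hw)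
    have h1 := hw i
    simp only [stepSeq, Finset.sdiff_empty, Finset.mem_singleton, if_true] at h1
    rw [e1, rankOne_dl_ne, zero_apply, map_zero, sub_zero]
    rintro rfl
    omega
  change (rankOne y (dl x), (0 : Op (Box {i}))) ∈ asymp (boxWin ∅ {i})
  refine asymp_of_dl hW.1 (key x y) ?_
  rw [star_rankOne_dl, star_zero]
  exact key y x

/-- `T ↦ ∑_A (-1)^|A| ρ_A π_A(T)`. -/
noncomputable def altSum (n : ℕ) :
    tAlg (∅ : Finset (Fin n)) →ₗ[ℂ] Op (Box (∅ : Finset (Fin n))) :=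
  ∑ A : Finset (Fin n), (-1 : ℂ) ^ A.card •
    ((tAlg (∅ : Finset (Fin n))).subtype.toAlgHom.toLinearMap ∘ₗ rho A ∘ₗ
      projL (Finset.empty_subset A))

theorem altSum_apply (T : tAlg (∅ : Finset (Fin n))) :
    altSum n T = ∑ A : Finset (Fin n), (-1 : ℂ) ^ A.card •
      (rho A (proj (Finset.empty_subset A) T) : Op (Box (∅ : Finset (Fin n)))) := by
  rw [altSum, LinearMap.sum_apply]
  rfl

theorem continuous_altSum (n : ℕ) : Continuous (altSum n) := by
  have : ⇑(altSum n) = fun T => ∑ A : Finset (Fin n), (-1 : ℂ) ^ A.card •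
      (rho A (proj (Finset.empty_subset A) T) : Op (Box (∅ : Finset (Fin n)))) :=
    funext altSum_apply
  rw [this]
  refine continuous_finsetSum _ fun A _ => ?_
  have h : Continuous fun T : tAlg (∅ : Finset (Fin n)) =>
      (rho A (proj (Finset.empty_subset A) T) : Op (Box (∅ : Finset (Fin n)))) :=
    continuous_subtype_val.comp
      ((continuous_rho A).comp (continuous_proj (Finset.empty_subset A)))
  exact Continuous.const_smul h ((-1 : ℂ) ^ A.card)

theorem isCompactOperator_altSum (T : tAlg (∅ : Finset (Fin n))) :
    IsCompactOperator (altSum n T) := by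
  let S : Submodule ℂ (tAlg (∅ : Finset (Fin n))) :=
    (compactOperator (RingHom.id ℂ) (L2 (Box (∅ : Finset (Fin n)))) _).comap (altSum n)
  have hS : IsClosed (S : Set (tAlg (∅ : Finset (Fin n)))) :=
    isClosed_isCompactOperator.preimage (continuous_altSum n)
  refine mem_of_cutElem_mem S hS (fun c m => ?_) T
  have e : altSum n (cutElem ∅ c m) = cornerShift c m := by
    rw [altSum_apply, cornerShift]
    refine Finset.sum_congr rfl fun A _ => ?_
    rw [proj_cutElem, rho_cutElem]
    rfl
  change IsCompactOperator (altSum n (cutElem ∅ c m))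
  rw [e]
  exact isCompactOperator_cornerShift c m

theorem altSum_eq_self {T : tAlg (∅ : Finset (Fin n))}
    (hT : ∀ i, proj (Finset.empty_subset ({i} : Finset (Fin n))) T = 0) : altSum n T = T := by
  have h : ∀ A : Finset (Fin n), A.Nonempty → proj (Finset.empty_subset A) T = 0 := by
    rintro A ⟨i, hi⟩
    rw [← proj_proj (Finset.empty_subset {i}) (Finset.singleton_subset_iff.2 hi), hT, map_zero]
  rw [altSum_apply, Finset.sum_eq_single ∅]
  · rw [proj_self, rho_empty, Finset.card_empty, pow_zero, one_smul]
  · intro A _ hA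
    rw [h A (Finset.nonempty_iff_ne_empty.2 hA), map_zero]
    exact smul_zero _
  · exact fun h => absurd (Finset.mem_univ _) h

set_option synthInstance.maxHeartbeats 200000 in
/-- The kernel of `γ_n` consists of the compact operators. -/
theorem gammaN_eq_zero_iff (T : tAlg (∅ : Finset (Fin n))) :
    gammaN n T = 0 ↔ IsCompactOperator (T : Op (Box (∅ : Finset (Fin n)))) := by
  constructor
  · intro h
    have h1 : ∀ i, proj (Finset.empty_subset ({i} : Finset (Fin n))) T = 0 :=
      fun i => congrFun (congrArg Subtype.val h) i
    rw [← altSum_eq_self h1]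
    exact isCompactOperator_altSum T
  · intro h
    exact Subtype.ext (funext fun i => proj_eq_of_asymp (T := 0) _ (compact_asymp h i))

set_option synthInstance.maxHeartbeats 200000 in
theorem mem_range_compactInclusion (T : tAlg (∅ : Finset (Fin n))) :
    T ∈ Set.range (compactInclusion n) ↔ gammaN n T = 0 := by
  rw [gammaN_eq_zero_iff]
  constructor
  · rintro ⟨K, rfl⟩
    exact K.2
  · exact fun h => ⟨⟨T, h⟩, rfl⟩

theorem compactInclusion_injective (n : ℕ) : Function.Injective (compactInclusion n) :=
  fun _ _ h => Subtype.ext (Subtype.mk.inj h)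

end OrthantToeplitz

theorem mainTheorem4 (n : ℕ) (hn : 3 ≤ n) :
    -- `𝓣ⁿ = 𝓣 ⊗ ⋯ ⊗ 𝓣` is the algebra generated by the Toeplitz operators `P_n M_f P_n`
    tAlg (∅ : Finset (Fin n)) = orthantToeplitz n ∧
    -- `𝓢ⁿ` is a `C*`-subalgebra of `𝓣ⁿ_1 ⊕ ⋯ ⊕ 𝓣ⁿ_n`
    IsClosed (sAlg n : Set (∀ i : Fin n, tAlg {i})) ∧
    -- `0 → 𝓚 → 𝓣ⁿ → 𝓢ⁿ → 0` is exact, where the first map is the inclusion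
    (∃ ι : compactOps (L2 (Box (∅ : Finset (Fin n)))) →⋆ₙₐ[ℂ] tAlg (∅ : Finset (Fin n)),
      (∀ K, (ι K : Op (Box (∅ : Finset (Fin n)))) = K) ∧
      Function.Injective ι ∧
      (∀ T, T ∈ Set.range ι ↔ gammaN n T = 0) ∧
      Function.Surjective (gammaN n)) ∧
    -- `T_A = π^i_A(T_i)` does not depend on `i ∈ A`
    (∀ (T : sAlg n) (A : Finset (Fin n)) (hA : A.Nonempty) (i : Fin n) (hi : i ∈ A),
      proj (Finset.singleton_subset_iff.2 hi) ((T : ∀ i : Fin n, tAlg {i}) i) = face hA T) ∧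
    -- the compressions `ρ_A` split `π_A`, and the alternating sum `ρ'` splits `γ_n`
    ∃ ρ : ∀ A : Finset (Fin n), tAlg A →ₗ[ℂ] tAlg (∅ : Finset (Fin n)),
      (∀ A T, (ρ A T : Op (Box (∅ : Finset (Fin n)))) = compress (orthantEmb A) T) ∧
      (∀ A T, proj (Finset.empty_subset A) (ρ A T) = T) ∧
      ∃ ρ' : sAlg n →ₗ[ℂ] tAlg (∅ : Finset (Fin n)),
        (∀ T, ρ' T = ∑ k ∈ Finset.Icc 1 n,
          ∑ A : {A : Finset (Fin n) // A.card = k ∧ A.Nonempty},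
            (-1 : ℂ) ^ (k + 1) • ρ A (face A.2.2 T)) ∧
        ∀ T, gammaN n (ρ' T) = T := by
  refine ⟨(tAlg_eq_closure ∅).trans (orthantToeplitz_eq_closure n).symm, isClosed_sAlg n,
    ⟨compactInclusion n, fun _ => rfl, compactInclusion_injective n, mem_range_compactInclusion,
      fun T => ⟨splitting T, gammaN_splitting T⟩⟩,
    fun T A hA i hi => proj_eq_face T hA hi,
    ⟨rho, fun _ _ => rfl, proj_rho, ?_⟩⟩
  exact ⟨{ toFun := splitting, map_add' := splitting_add, map_smul' := splitting_smul },
    fun _ => rfl, gammaN_splitting⟩
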